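/- For complex parameters and integers $0\le m\le q$, $0\le n\le p$, let $$G^{m,n}_{p,q}\left(z\,\Big|\,{\alpha_1,\dots,\alpha_n;\alpha_{n+1},\dots,\alpha_p\atop \beta_1,\dots,\beta_m;\beta_{m+1},\dots,\beta_q}\right)=\frac1{2\pi i}\int_L\frac{\prod_{j=1}^m\Gamma(\beta_j-\zeta)\prod_{j=1}^n\Gamma(1-\alpha_j+\zeta)}{\prod_{j=m+1}^q\Gamma(1-\beta_j+\zeta)\prod_{j=n+1}^p\Gamma(\alpha_j-\zeta)}\,z^\zeta\,d\zeta$$ be the Meijer $G$-function, where $L$ is an upward vertical line separating the poles of the $\Gamma(\beta_j-\zeta)$, $j\le m$ (to its right), from those of the $\Gamma(1-\alpha_j+\zeta)$, $j\le n$ (to its left); here $z\ne0$ lies on the Riemann surface of the logarithm and $z^\zeta=e^{\zeta(\log|z|+i\arg z)}$. **Theorem 1.** Let $\{\Theta(k)\}_{k\ge0}$ be a bounded sequence of complex numbers and let $\upsilon,b,c,\lambda\in\mathbb C$, $y\in\mathbb R$ satisfy $\Re(\upsilon)>0$, $\Re(c)>0$, $y>0$, either $\Re(\lambda)>0,\ \Re(b)>0$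 or $\Re(\lambda)<0,\ \Re(b)<0$, and $\Re(\lambda b)>0$. Put $a_k=\lambda b+ck$ (so $\Re(a_k)>0$), let powers of $a_k$ be principal, and let the arguments of $64y^2/a_k^4$ and $4^8y^4/a_k^8$ be $-4\arg a_k\in(-2\pi,2\pi)$ and $-8\arg a_k\in(-4\pi,4\pi)$, where $\arg a_k\in(-\frac\pi2,\frac\pi2)$. Then all integrals and series below converge absolutely (the $G$-function integrals along every separating vertical line, with a value independent of the line), and $$I_C^*(\upsilon,b,c,\lambda,y):=\sum_{k=0}^\infty\frac{\Theta(k)}{k!}\int_0^\infty x^{\upsilon-1}e^{-(\lambda b+ck)\sqrt x}\cos(xy)\,dx$$ is equal to each of the following: $$\frac{2^{4\upsilon-\frac32}}{\pi}\sum_{k=0}^\infty\frac{\Theta(k)}{k!\,a_k^{2\upsilon}}\,G^{1,4}_{4,2}\left(\frac{64y^2}{a_k^4}\,\Big|\,{\frac{4-2\upsilon}4,\frac{3-2\upsilon}4,\frac{2-2\upsilon}4,\frac{1-2\upsilon}4;-\atop 0;\frac12}\right),$$ $$\frac{\sqrt y\,2^{4\upsilon}}{\pi}\sum_{k=0}^\infty\frac{\Theta(k)}{k!\,a_k^{2\upsilon+1}}\,G^{1,4}_{4,2}\left(\frac{64y^2}{a_k^4}\,\Big|\,{\frac{3-2\upsilon}4,\frac{2-2\upsilon}4,\frac{1-2\upsilon}4,\frac{-2\upsilon}4;-\atop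 -\frac14;\frac14}\right),$$ $$\frac{2^{4\upsilon-\frac92}}{\pi y}\sum_{k=0}^\infty\frac{\Theta(k)}{k!\,a_k^{2\upsilon-2}}\,G^{1,4}_{4,2}\left(\frac{64y^2}{a_k^4}\,\Big|\,{\frac{6-2\upsilon}4,\frac{5-2\upsilon}4,\frac{4-2\upsilon}4,\frac{3-2\upsilon}4;-\atop \frac12;1}\right),$$ $$\frac{y\,2^{4\upsilon+\frac32}}{\pi}\sum_{k=0}^\infty\frac{\Theta(k)}{k!\,a_k^{2\upsilon+2}}\,G^{1,4}_{4,2}\left(\frac{64y^2}{a_k^4}\,\Big|\,{\frac{2-2\upsilon}4,\frac{1-2\upsilon}4,\frac{-2\upsilon}4,\frac{-1-2\upsilon}4;-\atop -\frac12;0}\right),$$ $$\frac{2^{6\upsilon-\frac72}}{\pi^3}\sum_{k=0}^\infty\frac{\Theta(k)}{k!\,a_k^{2\upsilon}}\,G^{2,8}_{8,4}\left(\frac{4^8y^4}{a_k^8}\,\Big|\,{\frac{8-2\upsilon}8,\frac{7-2\upsilon}8,\frac{6-2\upsilon}8,\frac{5-2\upsilon}8,\frac{4-2\upsilon}8,\frac{3-2\upsilon}8,\frac{2-2\upsilon}8,\frac{1-2\upsilon}8;-\atop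 0,\frac12;\frac14,\frac34}\right).$$ -/

import Mathlib

noncomputable section

namespace RamanujanCosine

open MeasureTheory

/-! ### The Meijer `G`-function

`G^{m,n}_{p,q}` has upper parameters `α₁,…,αₙ; αₙ₊₁,…,α_p` and lower parameters
`β₁,…,β_m; β_{m+1},…,β_q`. The four groups are four vectors: `a : Fin n → ℂ` (first upper group),
`a' : Fin r → ℂ` with `p = n + r`, `b : Fin m → ℂ` (first lower group) and `b' : Fin s → ℂ` with
`q = m + s`.

The function lives on the Riemann surface of the logarithm (its contour integral converges for
`|arg z| < π (m + n - (p + q) / 2)`, a sector that can be wider than the slit plane). Its argument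
is therefore given by a logarithm `w` of `z`, so that `z = exp w`, `arg z = Im w` and
`z ^ ζ = exp (w * ζ)`. -/

/-- The Mellin-Barnes integrand
`∏ Γ(β_j - ζ) ∏ Γ(1 - α_j + ζ) / (∏ Γ(1 - β_j + ζ) ∏ Γ(α_j - ζ)) * z ^ ζ` with `z = exp w`. -/
def meijerIntegrand {m n r s : ℕ} (a : Fin n → ℂ) (a' : Fin r → ℂ) (b : Fin m → ℂ)
    (b' : Fin s → ℂ) (w ζ : ℂ) : ℂ :=
  ((∏ j, Complex.Gamma (b j - ζ)) * ∏ j, Complex.Gamma (1 - a j + ζ)) /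
    ((∏ j, Complex.Gamma (1 - b' j + ζ)) * ∏ j, Complex.Gamma (a' j - ζ)) * Complex.exp (w * ζ)

/-- The upward vertical line `Re ζ = γ` separates the poles of the `Γ(β_j - ζ)`, `j ≤ m`
(the points `β_j + l`, `l = 0, 1, 2, …`), which lie to its right, from the poles of the
`Γ(1 - α_j + ζ)`, `j ≤ n` (the points `α_j - 1 - l`), which lie to its left. -/
def IsSeparatingLine {m n : ℕ} (a : Fin n → ℂ) (b : Fin m → ℂ) (γ : ℝ) : Prop :=
  (∀ (j : Fin m) (l : ℕ), γ < (b j + l).re) ∧ ∀ (j : Fin n) (l : ℕ), (a j - 1 - l).re < γ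

/-- `(1 / (2 π i)) ∫ … dζ` along the line `ζ = γ + i t`, `t` from `-∞` to `∞` (`dζ = i dt`). -/
def meijerLineIntegral {m n r s : ℕ} (a : Fin n → ℂ) (a' : Fin r → ℂ) (b : Fin m → ℂ)
    (b' : Fin s → ℂ) (w : ℂ) (γ : ℝ) : ℂ :=
  1 / (2 * (Real.pi : ℂ) * Complex.I) *
    ∫ t : ℝ, meijerIntegrand a a' b b' w ((γ : ℂ) + (t : ℂ) * Complex.I) * Complex.I

open Classical in
/-- The Meijer function `G^{m,n}_{n+r,m+s}(z | a; a' // b; b')` at `z = exp w`, for parameters whose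
two families of poles can be separated by a vertical line. -/
def meijerG {m n r s : ℕ} (a : Fin n → ℂ) (a' : Fin r → ℂ) (b : Fin m → ℂ) (b' : Fin s → ℂ)
    (w : ℂ) : ℂ :=
  if h : ∃ γ : ℝ, IsSeparatingLine a b γ then meijerLineIntegral a a' b b' w h.choose else 0

/-- The value `meijerG a a' b b' w` is meaningful: a separating line exists, the contour integral
converges absolutely along every such line, and its value does not depend on the line. -/
def MeijerGConverges {m n r s : ℕ} (a : Fin n → ℂ) (a' : Fin r → ℂ) (b : Fin m → ℂ)
    (b' : Fin s → ℂ) (w : ℂ) : Prop :=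
  (∃ γ : ℝ, IsSeparatingLine a b γ) ∧
    ∀ γ : ℝ, IsSeparatingLine a b γ →
      Integrable (fun t : ℝ => meijerIntegrand a a' b b' w ((γ : ℂ) + (t : ℂ) * Complex.I)) ∧
        meijerLineIntegral a a' b b' w γ = meijerG a a' b b' w

/-! ### The generalized Ramanujan cosine integral -/

/-- `x ^ (υ - 1) * exp (-(λ b + c k) √x) * cos (x y)`. -/
def cosIntegrand (υ b c lam : ℂ) (y : ℝ) (k : ℕ) (x : ℝ) : ℂ :=
  (x : ℂ) ^ (υ - 1) * Complex.exp (-(lam * b + c * k) * (Real.sqrt x : ℂ)) *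
    (Real.cos (x * y) : ℂ)

/-- `Θ(k) / k! * ∫₀^∞ x ^ (υ - 1) * exp (-(λ b + c k) √x) * cos (x y) dx`. -/
def iStarTerm (Θ : ℕ → ℂ) (υ b c lam : ℂ) (y : ℝ) (k : ℕ) : ℂ :=
  Θ k / (k.factorial : ℂ) * ∫ x in Set.Ioi (0 : ℝ), cosIntegrand υ b c lam y k x

/-- `I*_C(υ, b, c, λ, y)`, the sum of the terms above over `k = 0, 1, 2, …`. -/
def iStar (Θ : ℕ → ℂ) (υ b c lam : ℂ) (y : ℝ) : ℂ :=
  ∑' k : ℕ, iStarTerm Θ υ b c lam y k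

/-- The logarithm `log (64 y²) - 4 Log (λ b + c k)` of `64 y² / (λ b + c k)⁴`, that is, the argument
of this quotient is `-4 arg (λ b + c k)`. -/
def logArg₄ (b c lam : ℂ) (y : ℝ) (k : ℕ) : ℂ :=
  (Real.log (64 * y ^ 2) : ℂ) - 4 * Complex.log (lam * b + c * k)

/-- The logarithm `log (4⁸ y⁴) - 8 Log (λ b + c k)` of `4⁸ y⁴ / (λ b + c k)⁸`, that is, the argument
of this quotient is `-8 arg (λ b + c k)`. -/
def logArg₈ (b c lam : ℂ) (y : ℝ) (k : ℕ) : ℂ :=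
  (Real.log (4 ^ 8 * y ^ 4) : ℂ) - 8 * Complex.log (lam * b + c * k)

theorem exp_logArg₄ (b c lam : ℂ) (y : ℝ) (k : ℕ) (hy : 0 < y) (h : lam * b + c * k ≠ 0) :
    Complex.exp (logArg₄ b c lam y k) = 64 * (y : ℂ) ^ 2 / (lam * b + c * k) ^ 4 := by
  have h4 : Complex.exp (4 * Complex.log (lam * b + c * k)) = (lam * b + c * k) ^ 4 := by
    rw [show (4 : ℂ) = ((4 : ℕ) : ℂ) by norm_num, Complex.exp_nat_mul, Complex.exp_log h]
  rw [logArg₄, Complex.exp_sub, h4, ← Complex.ofReal_exp, Real.exp_log (by positivity)]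
  push_cast
  rfl

theorem exp_logArg₈ (b c lam : ℂ) (y : ℝ) (k : ℕ) (hy : 0 < y) (h : lam * b + c * k ≠ 0) :
    Complex.exp (logArg₈ b c lam y k) = 4 ^ 8 * (y : ℂ) ^ 4 / (lam * b + c * k) ^ 8 := by
  have h8 : Complex.exp (8 * Complex.log (lam * b + c * k)) = (lam * b + c * k) ^ 8 := by
    rw [show (8 : ℂ) = ((8 : ℕ) : ℂ) by norm_num, Complex.exp_nat_mul, Complex.exp_log h]
  rw [logArg₈, Complex.exp_sub, h8, ← Complex.ofReal_exp, Real.exp_log (by positivity)]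
  push_cast
  rfl

end RamanujanCosine

end

namespace RamanujanCosine

open MeasureTheory Set Filter Topology

/-! For each `k` the cosine integral `J` is written as a Mellin-Barnes integral, and each
`G`-function is the same integral after an affine change of variable.

For `Re p > 0`, Mellin inversion gives `exp(-p x)` as an integral of `(p x)^(-s) Γ(s)` over a
vertical line. Inserting this and integrating first in `x` produces `a^(-2(υ-s)) Γ(2(υ-s))`
(`laplace_eq_mellinBarnes`). The decay of `Γ(2(υ-s))` leaves room to let `p` tend to the imaginary
axis (`norm_laplaceKernel_le`); averaging `p = iy` and `p = -iy` gives the cosine, with kernel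
`cosKernel`, on every line `0 < Re s < Re υ` (`integral_cos_eq_mellinBarnes`).

Put `s = -2ζ`. The multiplication formula merges the four upper Gamma factors into `Γ(2(υ-s))`,
while reflection and duplication turn `Γ(-ζ)/Γ(1/2+ζ)` into a multiple of `Γ(s) cos(πs/2)`, so the
first Meijer integrand is a constant times `cosKernel` (`meijerIntegrand_eq_cosKernel`). The next
three forms are translations of `ζ` by a real `d`; the last one is `ζ ↦ 2ζ` combined with
duplication of every Gamma factor.

Separating lines correspond exactly to `0 < Re s < Re υ`. On all of them the integral equals `π J`,
so independence of the line needs no contour shift. Since `Re(c k) ≥ 0`, the integrals are bounded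
uniformly in `k`, and `1/k!` makes the series converge. -/

/-! ### The Gamma integral with a complex rate, and the decay of `Γ` on vertical lines -/

theorem aestronglyMeasurable_cpow_mul_cexp (s p : ℂ) : AEStronglyMeasurable
    (fun x : ℝ => (x : ℂ) ^ (s - 1) * Complex.exp (-p * x)) (volume.restrict (Ioi 0)) := by
  refine ContinuousOn.aestronglyMeasurable (fun x hx => ?_) measurableSet_Ioi
  refine ContinuousAt.continuousWithinAt (ContinuousAt.mul ?_ (by fun_prop))
  exact Complex.continuousAt_ofReal_cpow_const _ _ (Or.inr (ne_of_gt hx))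

theorem integrableOn_cpow_mul_exp_neg_mul {s p : ℂ} (hs : 0 < s.re) (hp : 0 < p.re) :
    IntegrableOn (fun x : ℝ => (x : ℂ) ^ (s - 1) * Complex.exp (-p * x)) (Ioi 0) := by
  have h := integrableOn_rpow_mul_exp_neg_mul_rpow (s := s.re - 1) (by linarith) one_pos hp
  refine Integrable.mono' h (aestronglyMeasurable_cpow_mul_cexp s p) ?_
  filter_upwards [ae_restrict_mem measurableSet_Ioi] with x hx
  rw [norm_mul, Complex.norm_cpow_eq_rpow_re_of_pos hx, Complex.norm_exp]
  simp

/-- Both sides are holomorphic in `p` on the right half-plane and agree for positive real `p`, so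
the identity theorem applies. -/
theorem integral_cpow_mul_cexp_neg_mul {s p : ℂ} (hs : 0 < s.re) (hp : 0 < p.re) :
    ∫ x : ℝ in Ioi 0, (x : ℂ) ^ (s - 1) * Complex.exp (-p * x) = p ^ (-s) * Complex.Gamma s := by
  let U : Set ℂ := {z | 0 < z.re}
  have hU : IsOpen U := isOpen_lt continuous_const Complex.continuous_re
  have hd : DifferentiableOn ℂ
      (fun q : ℂ => ∫ x : ℝ in Ioi 0, (x : ℂ) ^ (s - 1) * Complex.exp (-q * x)) U := by
    intro q hq
    have hq' : 0 < q.re := hq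
    -- Differentiating in `q` costs a factor `x`. On `Re z > Re q / 2` the derivative is dominated
    -- by `x^(Re s) exp(-x Re q / 2)`.
    have hb := integrableOn_rpow_mul_exp_neg_mul_rpow (s := s.re) (by linarith) one_pos (half_pos hq')
    refine ((hasDerivAt_integral_of_dominated_loc_of_deriv_le (𝕜 := ℂ)
      (F := fun (z : ℂ) (x : ℝ) => (x : ℂ) ^ (s - 1) * Complex.exp (-z * x))
      (F' := fun (z : ℂ) (x : ℝ) => (x : ℂ) ^ (s - 1) * (Complex.exp (-z * x) * (-x)))
      (s := {z : ℂ | q.re / 2 < z.re})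
      ((isOpen_lt continuous_const Complex.continuous_re).mem_nhds
        (by change q.re / 2 < q.re; linarith))
      (Eventually.of_forall (aestronglyMeasurable_cpow_mul_cexp s)) (integrableOn_cpow_mul_exp_neg_mul hs hq')
      ?_ ?_ hb ?_).2.differentiableAt).differentiableWithinAt
    · refine ((aestronglyMeasurable_cpow_mul_cexp s q).mul (g := fun x : ℝ => (-x : ℂ)) ?_).congr ?_
      · exact Continuous.aestronglyMeasurable (by fun_prop)
      · exact Eventually.of_forall fun x => by simp [mul_assoc]
    · filter_upwards [ae_restrict_mem measurableSet_Ioi] with x hx z hz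
      have hx' : 0 < x := hx
      rw [norm_mul, norm_mul, Complex.norm_cpow_eq_rpow_re_of_pos hx, Complex.norm_exp]
      have e : x ^ s.re = x ^ (s - 1).re * x := by
        rw [← Real.rpow_add_one hx'.ne']; simp
      have h1 : Real.exp ((-z * x).re) ≤ Real.exp (-(q.re / 2) * x ^ (1 : ℝ)) := by
        apply Real.exp_le_exp.2
        have hz' : q.re / 2 < z.re := hz
        simp only [Complex.mul_re, Complex.neg_re, Complex.ofReal_re, Complex.ofReal_im,
          Real.rpow_one]
        nlinarith
      rw [e, norm_neg, Complex.norm_real, Real.norm_of_nonneg hx'.le]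
      calc _ = x ^ (s - 1).re * x * Real.exp ((-z * x).re) := by ring
        _ ≤ _ := by gcongr
    · filter_upwards with x z _
      refine (((hasDerivAt_id z).neg.mul_const (x : ℂ)).cexp.const_mul _).congr_deriv ?_
      simp
  have hd2 : DifferentiableOn ℂ (fun q : ℂ => q ^ (-s) * Complex.Gamma s) U := by
    intro q hq
    exact ((differentiableAt_id.cpow_const (Or.inl hq)).mul_const _).differentiableWithinAt
  have hconv : Convex ℝ U := convex_halfSpace_re_gt 0
  have h1 : (1 : ℂ) ∈ U := by simp [U]
  refine (hd.analyticOnNhd hU).eqOn_of_preconnected_of_frequently_eq (hd2.analyticOnNhd hU)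
    hconv.isPreconnected h1 ?_ hp
  -- The real points `1 + 1/(n+1)` accumulate at `1` without reaching it.
  have hseq : Tendsto (fun n : ℕ => (1 : ℂ) + ((1 / ((n : ℝ) + 1) : ℝ) : ℂ)) atTop (𝓝[≠] 1) := by
    refine tendsto_nhdsWithin_iff.2 ⟨?_, Eventually.of_forall fun n => ?_⟩
    · have := (Complex.continuous_ofReal.tendsto 0).comp
        (tendsto_one_div_add_atTop_nhds_zero_nat (𝕜 := ℝ))
      simpa using this.const_add (1 : ℂ)
    · have : (0 : ℝ) < 1 / ((n : ℝ) + 1) := by positivity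
      simp only [mem_compl_iff, mem_singleton_iff, add_eq_left, Complex.ofReal_eq_zero]
      exact this.ne'
  refine hseq.frequently (Eventually.frequently (Eventually.of_forall fun n => ?_))
  have hr : (0 : ℝ) < 1 + 1 / ((n : ℝ) + 1) := by positivity
  have := Complex.integral_cpow_mul_exp_neg_mul_Ioi hs hr
  have e : (1 : ℂ) + ((1 / ((n : ℝ) + 1) : ℝ) : ℂ) = ((1 + 1 / ((n : ℝ) + 1) : ℝ) : ℂ) := by
    push_cast; rfl
  simp only [neg_mul, e]
  rw [this, one_div, Complex.inv_cpow _ _ (by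
    rw [Complex.arg_ofReal_of_nonneg hr.le]; exact Real.pi_pos.ne), Complex.cpow_neg]

/-- Exponential decay of `Γ` along vertical lines, from the Gamma integral over a rotated ray. -/
theorem norm_Gamma_le {s : ℂ} (hs : 0 < s.re) {θ : ℝ} (h0 : 0 ≤ θ) (h1 : θ < Real.pi / 2) :
    ‖Complex.Gamma s‖ ≤
      Real.Gamma s.re * (1 / Real.cos θ) ^ s.re * Real.exp (-θ * |s.im|) := by
  -- At `p = exp(iφ)` the modulus of `p^(-s)` is `exp(φ Im s)`, whereas the integral is at most its
  -- value with `Re s` and `cos φ` in place of `s` and `p`. Below, `φ = ±θ` takes the sign of `Im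
  -- s`.
  have key : ∀ φ : ℝ, |φ| < Real.pi / 2 → ‖Complex.Gamma s‖ * Real.exp (φ * s.im) ≤
      Real.Gamma s.re * (1 / Real.cos φ) ^ s.re := by
    intro φ hφ
    have hφ' := abs_lt.1 hφ
    have hc : 0 < Real.cos φ := Real.cos_pos_of_mem_Ioo ⟨hφ'.1, hφ'.2⟩
    have hre : (Complex.exp (φ * Complex.I)).re = Real.cos φ := Complex.exp_ofReal_mul_I_re φ
    have h := integral_cpow_mul_cexp_neg_mul (p := Complex.exp (φ * Complex.I)) hs (by rwa [hre])
    have hn : ‖Complex.exp (φ * Complex.I) ^ (-s)‖ = Real.exp (φ * s.im) := by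
      rw [Complex.norm_cpow_of_ne_zero (Complex.exp_ne_zero _), Complex.norm_exp_ofReal_mul_I,
        Complex.arg_exp_mul_I, toIocMod_eq_self (Real.two_pi_pos) |>.2]
      · simp [Real.exp_neg]
      · constructor <;> linarith [Real.pi_pos]
    have h2 := congrArg norm h
    rw [norm_mul, hn] at h2
    rw [mul_comm, ← h2, mul_comm (Real.Gamma _), ← Real.integral_rpow_mul_exp_neg_mul_Ioi hs hc]
    refine (norm_integral_le_integral_norm _).trans_eq
      (setIntegral_congr_fun measurableSet_Ioi fun x hx => ?_)
    simp only [norm_mul, Complex.norm_cpow_eq_rpow_re_of_pos hx, Complex.norm_exp]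
    simp [hre]
  have hc : 0 < Real.cos θ := Real.cos_pos_of_mem_Ioo ⟨by linarith, h1⟩
  rw [neg_mul, Real.exp_neg, ← div_eq_mul_inv, le_div_iff₀ (Real.exp_pos _)]
  rcases le_total 0 s.im with h | h
  · rw [abs_of_nonneg h]
    exact key θ (by rwa [abs_of_nonneg h0])
  · rw [abs_of_nonpos h, mul_neg, ← neg_mul, ← Real.cos_neg θ]
    exact key (-θ) (by rwa [abs_neg, abs_of_nonneg h0])

theorem integrable_exp_neg_mul_abs {δ : ℝ} (hδ : 0 < δ) :
    Integrable fun t : ℝ => Real.exp (-δ * |t|) := by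
  have hi : IntegrableOn (fun t : ℝ => Real.exp (-δ * |t|)) (Ioi 0) := by
    refine (integrableOn_exp_mul_Ioi (a := -δ) (by linarith) 0).congr_fun (fun x hx => ?_)
      measurableSet_Ioi
    simp [abs_of_pos (show 0 < x from hx)]
  have hi' : IntegrableOn (fun t : ℝ => Real.exp (-δ * |t|)) (Iic 0) := by
    refine (integrableOn_exp_mul_Iic (a := δ) hδ 0).congr_fun (fun x hx => ?_)
      measurableSet_Iic
    simp [abs_of_nonpos (show x ≤ 0 from hx)]
  rw [← integrableOn_univ, ← Iic_union_Ioi (a := (0 : ℝ))]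
  exact hi'.union hi

/-! ### Mellin-Barnes form of the Laplace transform of `x^(υ-1) exp(-a √x)` -/

theorem sqrt_laplace_integrableOn {υ a : ℂ} (hυ : 0 < υ.re) (ha : 0 < a.re) :
    IntegrableOn (fun x : ℝ => (x : ℂ) ^ (υ - 1) * Complex.exp (-a * (Real.sqrt x : ℂ)))
      (Ioi 0) := by
  have h : MellinConvergent (fun u : ℝ => Complex.exp (-a * (u : ℂ))) (υ / ((1 / 2 : ℝ) : ℂ)) :=
    integrableOn_cpow_mul_exp_neg_mul (by simpa using hυ) ha
  rw [← MellinConvergent.comp_rpow (by norm_num)] at h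
  simpa only [MellinConvergent, smul_eq_mul, Real.sqrt_eq_rpow] using h

/-- The substitution `x = u²` reduces this to the Gamma integral at `2υ`; the factor `2` comes from
`dx = 2u du`. -/
theorem sqrt_laplace_integral {υ a : ℂ} (hυ : 0 < υ.re) (ha : 0 < a.re) :
    ∫ x : ℝ in Ioi 0, (x : ℂ) ^ (υ - 1) * Complex.exp (-a * (Real.sqrt x : ℂ)) =
      2 * (a ^ (-(2 * υ)) * Complex.Gamma (2 * υ)) := by
  have h := mellin_comp_rpow (fun u : ℝ => Complex.exp (-a * (u : ℂ))) υ (1 / 2)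
  have e : υ / ((1 / 2 : ℝ) : ℂ) = 2 * υ := by push_cast; ring
  have h2 := integral_cpow_mul_cexp_neg_mul (s := 2 * υ) (by simpa using hυ) ha
  simp only [mellin, smul_eq_mul, e, h2, ← Real.sqrt_eq_rpow] at h
  rw [h, abs_of_pos (by norm_num)]
  norm_num

theorem continuousAt_Gamma_of_re_pos {s : ℂ} (hs : 0 < s.re) : ContinuousAt Complex.Gamma s :=
  (Complex.differentiableAt_Gamma s fun m h => by
    rw [h] at hs; simp at hs; linarith [Nat.cast_nonneg (α := ℝ) m]).continuousAt

theorem norm_cpow_le_exp_abs {z : ℂ} (hz : z ≠ 0) {φ : ℝ} (hφ : |Complex.arg z| ≤ φ) (w : ℂ) :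
    ‖z ^ w‖ ≤ ‖z‖ ^ w.re * Real.exp (φ * |w.im|) := by
  rw [Complex.norm_cpow_of_ne_zero hz, div_eq_mul_inv, ← Real.exp_neg]
  gcongr
  calc -(z.arg * w.im) ≤ |z.arg * w.im| := neg_le_abs _
    _ = |z.arg| * |w.im| := abs_mul _ _
    _ ≤ _ := by gcongr

theorem continuous_cpow_mul_Gamma_line {p : ℂ} (hp : p ≠ 0) {σ : ℝ} (hσ : 0 < σ) :
    Continuous fun t : ℝ => p ^ (-((σ : ℂ) + t * Complex.I)) *
      Complex.Gamma ((σ : ℂ) + t * Complex.I) := by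
  refine Continuous.mul (Continuous.const_cpow (by fun_prop) (Or.inl hp)) ?_
  refine continuous_iff_continuousAt.2 fun t => ?_
  exact (continuousAt_Gamma_of_re_pos (by simpa using hσ)).comp
    (f := fun t : ℝ => (σ : ℂ) + t * Complex.I) (by fun_prop)

theorem integrable_cpow_mul_Gamma_line {p : ℂ} (hp : 0 < p.re) {σ : ℝ} (hσ : 0 < σ) :
    Integrable fun t : ℝ => p ^ (-((σ : ℂ) + t * Complex.I)) *
      Complex.Gamma ((σ : ℂ) + t * Complex.I) := by
  have hp0 : p ≠ 0 := fun h => by simp [h] at hp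
  have harg : |p.arg| < Real.pi / 2 := Complex.abs_arg_lt_pi_div_two_iff.2 (Or.inl hp)
  -- With `|arg p| < θ < π/2`, the decay `exp(-θ|t|)` of `Γ` beats the growth `exp(|arg p| |t|)` of
  -- the power.
  obtain ⟨θ, h1, h2⟩ := exists_between harg
  refine Integrable.mono' (((integrable_exp_neg_mul_abs (sub_pos.2 h1)).const_mul
    (‖p‖ ^ (-σ) * (Real.Gamma σ * (1 / Real.cos θ) ^ σ))))
    (continuous_cpow_mul_Gamma_line hp0 hσ).aestronglyMeasurable
    (Eventually.of_forall fun t => ?_)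
  have hs : 0 < ((σ : ℂ) + t * Complex.I).re := by simpa using hσ
  have b1 := norm_Gamma_le hs ((abs_nonneg _).trans h1.le) h2
  have b2 := norm_cpow_le_exp_abs hp0 le_rfl (-((σ : ℂ) + t * Complex.I))
  simp only [Complex.neg_re, Complex.neg_im, Complex.add_re, Complex.add_im, Complex.ofReal_re,
    Complex.ofReal_im, Complex.mul_re, Complex.mul_im, Complex.I_re, Complex.I_im, mul_zero, mul_one,
    sub_zero, zero_add, add_zero, abs_neg] at b1 b2
  rw [norm_mul]
  calc _ ≤ (‖p‖ ^ (-σ) * Real.exp (|p.arg| * |t|)) *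
        (Real.Gamma σ * (1 / Real.cos θ) ^ σ * Real.exp (-θ * |t|)) :=
        mul_le_mul b2 b1 (norm_nonneg _) (by positivity)
    _ = ‖p‖ ^ (-σ) * (Real.Gamma σ * (1 / Real.cos θ) ^ σ) *
        (Real.exp (|p.arg| * |t|) * Real.exp (-θ * |t|)) := by ring
    _ = _ := by
        rw [← Real.exp_add]
        congr 2; ring

theorem exp_neg_mul_eq_mellinBarnes {p : ℂ} (hp : 0 < p.re) {σ : ℝ} (hσ : 0 < σ) {x : ℝ}
    (hx : 0 < x) :
    Complex.exp (-p * x) = (1 / (2 * Real.pi) : ℂ) * ∫ t : ℝ,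
      (x : ℂ) ^ (-((σ : ℂ) + t * Complex.I)) * (p ^ (-((σ : ℂ) + t * Complex.I)) *
        Complex.Gamma ((σ : ℂ) + t * Complex.I)) := by
  have hm : ∀ t : ℝ, mellin (fun x : ℝ => Complex.exp (-p * x)) ((σ : ℂ) + t * Complex.I) =
      p ^ (-((σ : ℂ) + t * Complex.I)) * Complex.Gamma ((σ : ℂ) + t * Complex.I) := fun t =>
    integral_cpow_mul_cexp_neg_mul (by simpa using hσ) hp
  have h := mellinInv_mellin_eq σ (fun x : ℝ => Complex.exp (-p * x)) hx
    (integrableOn_cpow_mul_exp_neg_mul (by simpa using hσ) hp)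
    (by
      simp only [Complex.VerticalIntegrable, hm]
      exact integrable_cpow_mul_Gamma_line hp hσ) (by fun_prop)
  rw [← h, mellinInv]
  simp only [hm, smul_eq_mul, Complex.real_smul]
  push_cast
  rfl

/-- The Mellin-Barnes kernel `p^(-s) Γ(s) a^(-2(υ-s)) Γ(2(υ-s))` of the Laplace transform of
`x^(υ-1) exp(-a √x)`. -/
noncomputable def laplaceKernel (υ a p s : ℂ) : ℂ :=
  p ^ (-s) * Complex.Gamma s * (a ^ (-(2 * (υ - s))) * Complex.Gamma (2 * (υ - s)))

theorem laplace_eq_mellinBarnes {υ a p : ℂ} (ha : 0 < a.re) (hp : 0 < p.re) {σ : ℝ} (hσ : 0 < σ)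
    (hσ' : σ < υ.re) :
    ∫ x : ℝ in Ioi 0, (x : ℂ) ^ (υ - 1) * Complex.exp (-a * (Real.sqrt x : ℂ)) *
        Complex.exp (-p * x) =
      (1 / Real.pi : ℂ) * ∫ t : ℝ, laplaceKernel υ a p ((σ : ℂ) + t * Complex.I) := by
  have hp0 : p ≠ 0 := fun h => by simp [h] at hp
  let F : ℝ → ℝ → ℂ := fun x t => ((x : ℂ) ^ (υ - 1) * Complex.exp (-a * (Real.sqrt x : ℂ))) *
    ((x : ℂ) ^ (-((σ : ℂ) + t * Complex.I)) * (p ^ (-((σ : ℂ) + t * Complex.I)) *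
        Complex.Gamma ((σ : ℂ) + t * Complex.I)))
  have hF : ∀ x : ℝ, 0 < x → ∀ t : ℝ, F x t =
      ((x : ℂ) ^ ((υ - ((σ : ℂ) + t * Complex.I)) - 1) * Complex.exp (-a * (Real.sqrt x : ℂ))) *
      (p ^ (-((σ : ℂ) + t * Complex.I)) * Complex.Gamma ((σ : ℂ) + t * Complex.I)) := by
    intro x hx t
    have : (x : ℂ) ^ ((υ - ((σ : ℂ) + t * Complex.I)) - 1) =
        (x : ℂ) ^ (υ - 1) * (x : ℂ) ^ (-((σ : ℂ) + t * Complex.I)) := by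
      rw [← Complex.cpow_add _ _ (by exact_mod_cast hx.ne')]
      congr 1; ring
    rw [this]; ring
  have hint : Integrable (Function.uncurry F) ((volume.restrict (Ioi 0)).prod volume) := by
    -- The modulus of `x^(-(σ+it))` does not depend on `t`, so `F` has the modulus of a product of a
    -- function of `x` and a function of `t`, each integrable.
    have hprod := (sqrt_laplace_integrableOn (υ := υ - σ) (by simpa using hσ') ha).mul_prod
      (integrable_cpow_mul_Gamma_line hp hσ)
    refine hprod.mono ?_ ?_
    · apply Measurable.aestronglyMeasurable
      have h1 := (continuous_cpow_mul_Gamma_line hp0 hσ).measurable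
      have h2 : Measurable fun z : ℝ × ℝ => p ^ (-((σ : ℂ) + z.2 * Complex.I)) *
        Complex.Gamma ((σ : ℂ) + z.2 * Complex.I) := h1.comp measurable_snd
      refine Measurable.mul ?_ (Measurable.mul ?_ h2)
      · exact (Measurable.pow (by fun_prop) (by fun_prop)).mul (by fun_prop)
      · exact Measurable.pow (by fun_prop) (by fun_prop)
    · rw [Measure.restrict_prod_eq_prod_univ]
      filter_upwards [ae_restrict_mem (measurableSet_Ioi.prod MeasurableSet.univ)] with z hz
      have hz' : 0 < z.1 := hz.1
      refine le_of_eq ?_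
      rw [Function.uncurry, hF z.1 hz' z.2]
      simp only [norm_mul, Complex.norm_cpow_eq_rpow_re_of_pos hz']
      simp
  calc _ = ∫ x : ℝ in Ioi 0, (1 / (2 * Real.pi) : ℂ) * ∫ t : ℝ, F x t := by
        refine setIntegral_congr_fun measurableSet_Ioi fun x hx => ?_
        simp only [F]
        rw [exp_neg_mul_eq_mellinBarnes hp hσ hx, integral_const_mul]
        ring
    _ = (1 / (2 * Real.pi) : ℂ) * ∫ t : ℝ, ∫ x : ℝ in Ioi 0, F x t := by
        rw [integral_const_mul, integral_integral_swap hint]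
    _ = (1 / (2 * Real.pi) : ℂ) * ∫ t : ℝ, 2 * laplaceKernel υ a p ((σ : ℂ) + t * Complex.I) := by
        congr 2 with t
        rw [setIntegral_congr_fun measurableSet_Ioi fun x hx => hF x hx t, integral_mul_const,
          sqrt_laplace_integral (by simpa using hσ') ha, laplaceKernel]
        ring
    _ = _ := by
        rw [integral_const_mul]
        ring

/-- The bound depends on `p` only through `‖p‖^(-σ)` and includes the imaginary axis, which makes it
a dominating function for the passage to the boundary. -/
theorem norm_laplaceKernel_le {υ a : ℂ} (ha : 0 < a.re) {σ : ℝ} (hσ : 0 < σ) (hσ' : σ < υ.re) :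
    ∃ C δ : ℝ, 0 ≤ C ∧ 0 < δ ∧ ∀ p : ℂ, p ≠ 0 → 0 ≤ p.re → ∀ t : ℝ,
      ‖laplaceKernel υ a p ((σ : ℂ) + t * Complex.I)‖ ≤
        ‖p‖ ^ (-σ) * (C * Real.exp (-δ * |t|)) := by
  have ha0 : a ≠ 0 := fun h => by simp [h] at ha
  have harg : |a.arg| < Real.pi / 2 := Complex.abs_arg_lt_pi_div_two_iff.2 (Or.inl ha)
  have harg0 := abs_nonneg a.arg
  have hpi := Real.pi_pos
  -- The total exponent in `|t|` is `π/2 + 2|arg a| - 3θ`, and `θ < π/2` is required. This `θ` puts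
  -- `3θ` midway between `π/2 + 2|arg a|` and `3π/2`, leaving the rate `π/2 - |arg a|`.
  set θ : ℝ := Real.pi / 3 + |a.arg| / 3 with hθ
  have hθ0 : 0 ≤ θ := by positivity
  have hθ1 : θ < Real.pi / 2 := by linarith
  have hθa : 0 ≤ θ - |a.arg| := by linarith
  have hc : 0 < Real.cos θ := Real.cos_pos_of_mem_Ioo ⟨by linarith, hθ1⟩
  have hυσ : 0 < 2 * (υ.re - σ) := by linarith
  have hg1 := Real.Gamma_pos_of_pos hσ
  have hg2 := Real.Gamma_pos_of_pos hυσ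
  refine ⟨Real.Gamma σ * (1 / Real.cos θ) ^ σ * (‖a‖ ^ (-(2 * (υ.re - σ))) *
    (Real.Gamma (2 * (υ.re - σ)) * (1 / Real.cos θ) ^ (2 * (υ.re - σ)))) *
    Real.exp ((θ - |a.arg|) * (2 * |υ.im|)), Real.pi / 2 - |a.arg|, by positivity, by linarith,
    fun p hp hpre t => ?_⟩
  set s : ℂ := (σ : ℂ) + t * Complex.I with hs
  have hsre : s.re = σ := by simp [hs]
  have hsim : s.im = t := by simp [hs]
  have hre : (2 * (υ - s)).re = 2 * (υ.re - σ) := by simp [hsre]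
  have him : (2 * (υ - s)).im = 2 * (υ.im - t) := by simp [hsim]
  have b1 := norm_cpow_le_exp_abs hp (Complex.abs_arg_le_pi_div_two_iff.2 hpre) (-s)
  have b2 := norm_Gamma_le (s := s) (by rwa [hsre]) hθ0 hθ1
  have b3 := norm_cpow_le_exp_abs ha0 le_rfl (-(2 * (υ - s)))
  have b4 := norm_Gamma_le (s := 2 * (υ - s)) (by rwa [hre]) hθ0 hθ1
  rw [Complex.neg_re, Complex.neg_im, abs_neg, hsre, hsim] at b1
  rw [hsre, hsim] at b2
  rw [Complex.neg_re, Complex.neg_im, abs_neg, hre, him] at b3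
  rw [hre, him] at b4
  have him' : 2 * |t| - 2 * |υ.im| ≤ |2 * (υ.im - t)| := by
    rw [abs_mul, abs_two]
    have := abs_sub_abs_le_abs_sub t υ.im
    rw [abs_sub_comm] at this
    linarith
  rw [laplaceKernel, norm_mul, norm_mul, norm_mul]
  calc _ ≤ ‖p‖ ^ (-σ) * Real.exp (Real.pi / 2 * |t|) *
        (Real.Gamma σ * (1 / Real.cos θ) ^ σ * Real.exp (-θ * |t|)) *
        (‖a‖ ^ (-(2 * (υ.re - σ))) * Real.exp (|a.arg| * |2 * (υ.im - t)|) *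
        (Real.Gamma (2 * (υ.re - σ)) * (1 / Real.cos θ) ^ (2 * (υ.re - σ)) *
          Real.exp (-θ * |2 * (υ.im - t)|))) := by gcongr
    _ = ‖p‖ ^ (-σ) * (Real.Gamma σ * (1 / Real.cos θ) ^ σ * (‖a‖ ^ (-(2 * (υ.re - σ))) *
        (Real.Gamma (2 * (υ.re - σ)) * (1 / Real.cos θ) ^ (2 * (υ.re - σ)))) *
        (Real.exp (Real.pi / 2 * |t|) * Real.exp (-θ * |t|) *
          Real.exp (|a.arg| * |2 * (υ.im - t)|) * Real.exp (-θ * |2 * (υ.im - t)|))) := by ring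
    _ ≤ ‖p‖ ^ (-σ) * (Real.Gamma σ * (1 / Real.cos θ) ^ σ * (‖a‖ ^ (-(2 * (υ.re - σ))) *
        (Real.Gamma (2 * (υ.re - σ)) * (1 / Real.cos θ) ^ (2 * (υ.re - σ)))) *
        (Real.exp ((θ - |a.arg|) * (2 * |υ.im|)) *
          Real.exp (-(Real.pi / 2 - |a.arg|) * |t|))) := by
        refine mul_le_mul_of_nonneg_left (mul_le_mul_of_nonneg_left ?_ (by positivity))
          (by positivity)
        simp only [← Real.exp_add]
        apply Real.exp_le_exp.2
        have := mul_le_mul_of_nonneg_left him' hθa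
        have h3 : 3 * θ = Real.pi + |a.arg| := by rw [hθ]; ring
        have h4 : 3 * θ * |t| = (Real.pi + |a.arg|) * |t| := by rw [h3]
        linarith
    _ = _ := by ring

theorem continuous_laplaceKernel_line {υ a p : ℂ} (ha : a ≠ 0) (hp : p ≠ 0) {σ : ℝ} (hσ : 0 < σ)
    (hσ' : σ < υ.re) :
    Continuous fun t : ℝ => laplaceKernel υ a p ((σ : ℂ) + t * Complex.I) := by
  refine (continuous_cpow_mul_Gamma_line hp hσ).mul (Continuous.mul
    (Continuous.const_cpow (by fun_prop) (Or.inl ha)) ?_)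
  refine continuous_iff_continuousAt.2 fun t => ?_
  exact (continuousAt_Gamma_of_re_pos (by simpa using hσ')).comp
    (f := fun t : ℝ => 2 * (υ - ((σ : ℂ) + t * Complex.I))) (by fun_prop)

theorem integrable_laplaceKernel_line {υ a p : ℂ} (ha : 0 < a.re) (hp : p ≠ 0) (hp' : 0 ≤ p.re)
    {σ : ℝ} (hσ : 0 < σ) (hσ' : σ < υ.re) :
    Integrable fun t : ℝ => laplaceKernel υ a p ((σ : ℂ) + t * Complex.I) := by
  obtain ⟨C, δ, -, hδ, h⟩ := norm_laplaceKernel_le ha hσ hσ'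
  exact Integrable.mono' (((integrable_exp_neg_mul_abs hδ).const_mul C).const_mul (‖p‖ ^ (-σ)))
    (continuous_laplaceKernel_line (fun h => by simp [h] at ha) hp hσ hσ').aestronglyMeasurable
    (Eventually.of_forall (h p hp hp'))

/-- `laplace_eq_mellinBarnes` extended to the boundary of the half-plane. -/
theorem laplace_eq_mellinBarnes_of_re_nonneg {υ a p : ℂ} (ha : 0 < a.re) (hp : p ≠ 0)
    (hp' : 0 ≤ p.re) {σ : ℝ} (hσ : 0 < σ) (hσ' : σ < υ.re) :
    ∫ x : ℝ in Ioi 0, (x : ℂ) ^ (υ - 1) * Complex.exp (-a * (Real.sqrt x : ℂ)) *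
        Complex.exp (-p * x) =
      (1 / Real.pi : ℂ) * ∫ t : ℝ, laplaceKernel υ a p ((σ : ℂ) + t * Complex.I) := by
  have hυ : 0 < υ.re := hσ.trans hσ'
  have ha0 : a ≠ 0 := fun h => by simp [h] at ha
  -- The closed right half-plane without `0` avoids the branch cut, so `q^(-s)` is continuous at
  -- `p`.
  have hslit : p ∈ Complex.slitPlane := by
    rw [Complex.mem_slitPlane_iff]
    by_contra! h
    exact hp (Complex.ext (le_antisymm h.1 hp') h.2)
  have hre : ∀ ε : ℝ, 0 < ε → 0 < (p + ε).re := fun ε hε => by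
    simp only [Complex.add_re, Complex.ofReal_re]; linarith
  have hne : ∀ ε : ℝ, 0 < ε → p + ε ≠ 0 := fun ε hε h => by
    have := hre ε hε
    simp [h] at this
  have hlim : Tendsto (fun ε : ℝ => p + ε) (𝓝[>] 0) (𝓝 p) := by
    have : Continuous fun ε : ℝ => p + ε := by fun_prop
    simpa using (this.tendsto 0).mono_left nhdsWithin_le_nhds
  have hL : Tendsto (fun ε : ℝ => ∫ x : ℝ in Ioi 0, (x : ℂ) ^ (υ - 1) *
      Complex.exp (-a * (Real.sqrt x : ℂ)) * Complex.exp (-(p + ε) * x)) (𝓝[>] 0)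
      (𝓝 (∫ x : ℝ in Ioi 0, (x : ℂ) ^ (υ - 1) * Complex.exp (-a * (Real.sqrt x : ℂ)) *
        Complex.exp (-p * x))) := by
    have hI := sqrt_laplace_integrableOn hυ ha
    refine tendsto_integral_filter_of_dominated_convergence _ ?_ ?_ hI.norm ?_
    · exact Eventually.of_forall fun ε => hI.aestronglyMeasurable.mul
        (Continuous.aestronglyMeasurable (by fun_prop))
    · filter_upwards [self_mem_nhdsWithin] with ε hε
      filter_upwards [ae_restrict_mem measurableSet_Ioi] with x hx
      rw [norm_mul]
      refine mul_le_of_le_one_right (norm_nonneg _) ?_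
      rw [Complex.norm_exp, Real.exp_le_one_iff]
      have h1 := hre ε hε
      have h2 : 0 < x := hx
      simp only [Complex.mul_re, Complex.neg_re, Complex.ofReal_re, Complex.ofReal_im, mul_zero,
        sub_zero]
      nlinarith
    · filter_upwards with x
      refine Tendsto.const_mul _ ?_
      exact (Complex.continuous_exp.tendsto _).comp ((hlim.neg).mul_const _)
  obtain ⟨C, δ, hC, hδ, hb⟩ := norm_laplaceKernel_le (υ := υ) ha hσ hσ'
  have hR : Tendsto (fun ε : ℝ => ∫ t : ℝ, laplaceKernel υ a (p + ε) ((σ : ℂ) + t * Complex.I))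
      (𝓝[>] 0) (𝓝 (∫ t : ℝ, laplaceKernel υ a p ((σ : ℂ) + t * Complex.I))) := by
    refine tendsto_integral_filter_of_dominated_convergence _ ?_ ?_
      (((integrable_exp_neg_mul_abs hδ).const_mul C).const_mul (‖p‖ ^ (-σ))) ?_
    · filter_upwards [self_mem_nhdsWithin] with ε hε
      exact (continuous_laplaceKernel_line ha0 (hne ε hε) hσ hσ').aestronglyMeasurable
    · filter_upwards [self_mem_nhdsWithin] with ε hε
      refine Eventually.of_forall fun t => (hb _ (hne ε hε) (hre ε hε).le t).trans ?_
      -- Since `Re p ≥ 0`, `‖p + ε‖ ≥ ‖p‖`, and the exponent `-σ` is negative.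
      refine mul_le_mul_of_nonneg_right ?_ (by positivity)
      refine Real.rpow_le_rpow_of_nonpos (norm_pos_iff.2 hp) ?_ (by linarith)
      have hε' : 0 < ε := hε
      rw [← sq_le_sq₀ (norm_nonneg _) (norm_nonneg _), Complex.sq_norm, Complex.sq_norm,
        Complex.normSq_apply, Complex.normSq_apply]
      simp only [Complex.add_re, Complex.add_im, Complex.ofReal_re, Complex.ofReal_im, add_zero]
      nlinarith
    · filter_upwards with t
      have hc : ContinuousAt (fun q : ℂ => q ^ (-((σ : ℂ) + t * Complex.I))) p :=
        continuousAt_cpow_const hslit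
      exact ((hc.tendsto.comp hlim).mul_const _).mul_const _
  refine tendsto_nhds_unique hL ((hR.const_mul (1 / Real.pi : ℂ)).congr' ?_)
  filter_upwards [self_mem_nhdsWithin] with ε hε
  exact (laplace_eq_mellinBarnes ha (hre ε hε) hσ hσ').symm

/-! ### The Mellin-Barnes integral of the cosine transform -/

/-- With principal powers, `(±i)^(-s) = exp(∓iπs/2)`, and the two average to `cos(πs/2)`. -/
theorem ofReal_cpow_neg_mul_cos {y : ℝ} (hy : 0 < y) (s : ℂ) :
    (y : ℂ) ^ (-s) * Complex.cos (Real.pi * s / 2) =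
      ((y * Complex.I : ℂ) ^ (-s) + (y * (-Complex.I) : ℂ) ^ (-s)) / 2 := by
  have hy0 : (y : ℂ) ≠ 0 := by exact_mod_cast hy.ne'
  rw [Complex.cpow_def_of_ne_zero hy0, Complex.cpow_def_of_ne_zero (by simp [hy0]),
    Complex.cpow_def_of_ne_zero (by simp [hy0]), Complex.log_ofReal_mul hy Complex.I_ne_zero,
    Complex.log_ofReal_mul hy (neg_ne_zero.2 Complex.I_ne_zero), Complex.log_I, Complex.log_neg_I,
    Complex.cos, ← Complex.ofReal_log hy.le, mul_div_assoc', mul_add, ← Complex.exp_add,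
    ← Complex.exp_add, add_comm]
  congr 3 <;> ring

/-- The Mellin-Barnes kernel of `∫ x^(υ-1) exp(-a √x) cos(xy) dx`. -/
noncomputable def cosKernel (υ a : ℂ) (y : ℝ) (s : ℂ) : ℂ :=
  (y : ℂ) ^ (-s) * Complex.cos (Real.pi * s / 2) * Complex.Gamma s *
    (a ^ (-(2 * (υ - s))) * Complex.Gamma (2 * (υ - s)))

theorem cosKernel_eq {υ a : ℂ} {y : ℝ} (hy : 0 < y) (s : ℂ) :
    cosKernel υ a y s = (laplaceKernel υ a (y * Complex.I) s +
      laplaceKernel υ a (y * (-Complex.I)) s) / 2 := by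
  rw [cosKernel, ofReal_cpow_neg_mul_cos hy, laplaceKernel, laplaceKernel]
  ring

theorem integrable_cosKernel_line {υ a : ℂ} (ha : 0 < a.re) {y : ℝ} (hy : 0 < y)
    {σ : ℝ} (hσ : 0 < σ) (hσ' : σ < υ.re) :
    Integrable fun t : ℝ => cosKernel υ a y ((σ : ℂ) + t * Complex.I) := by
  simp only [cosKernel_eq hy]
  exact ((integrable_laplaceKernel_line ha (by simp [hy.ne']) (by simp) hσ hσ').add
    (integrable_laplaceKernel_line ha (by simp [hy.ne']) (by simp) hσ hσ')).div_const 2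

theorem integrableOn_cos_integrand {υ a : ℂ} (hυ : 0 < υ.re) (ha : 0 < a.re) (y : ℝ) :
    IntegrableOn (fun x : ℝ => (x : ℂ) ^ (υ - 1) * Complex.exp (-a * (Real.sqrt x : ℂ)) *
      (Real.cos (x * y) : ℂ)) (Ioi 0) := by
  refine (sqrt_laplace_integrableOn hυ ha).mul_bdd (c := 1)
    (Continuous.aestronglyMeasurable (by fun_prop)) (Eventually.of_forall fun x => ?_)
  rw [Complex.norm_real]
  exact Real.abs_cos_le_one _

theorem integral_cos_eq_mellinBarnes {υ a : ℂ} (ha : 0 < a.re) {y : ℝ} (hy : 0 < y)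
    {σ : ℝ} (hσ : 0 < σ) (hσ' : σ < υ.re) :
    ∫ x : ℝ in Ioi 0, (x : ℂ) ^ (υ - 1) * Complex.exp (-a * (Real.sqrt x : ℂ)) *
        (Real.cos (x * y) : ℂ) =
      (1 / Real.pi : ℂ) * ∫ t : ℝ, cosKernel υ a y ((σ : ℂ) + t * Complex.I) := by
  have hυ : 0 < υ.re := hσ.trans hσ'
  have hI : ∀ p : ℂ, p.re = 0 → IntegrableOn (fun x : ℝ => (x : ℂ) ^ (υ - 1) *
      Complex.exp (-a * (Real.sqrt x : ℂ)) * Complex.exp (-p * x)) (Ioi 0) := by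
    intro p hp
    refine (sqrt_laplace_integrableOn hυ ha).mul_bdd (c := 1)
      (Continuous.aestronglyMeasurable (by fun_prop)) (Eventually.of_forall fun x => ?_)
    rw [Complex.norm_exp]
    simp [hp]
  have h1 := laplace_eq_mellinBarnes_of_re_nonneg (υ := υ) (p := y * Complex.I) ha
    (by simp [hy.ne']) (by simp) hσ hσ'
  have h2 := laplace_eq_mellinBarnes_of_re_nonneg (υ := υ) (p := y * (-Complex.I)) ha
    (by simp [hy.ne']) (by simp) hσ hσ'
  simp only [cosKernel_eq hy]
  rw [integral_div, integral_add
    (integrable_laplaceKernel_line ha (by simp [hy.ne']) (by simp) hσ hσ')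
    (integrable_laplaceKernel_line ha (by simp [hy.ne']) (by simp) hσ hσ'),
    mul_div_assoc', mul_add, ← h1, ← h2, ← integral_add (hI _ (by simp)) (hI _ (by simp)),
    ← integral_div]
  refine setIntegral_congr_fun measurableSet_Ioi fun x _ => ?_
  simp only [Complex.ofReal_cos, Complex.cos]
  push_cast
  rw [show (x : ℂ) * y * Complex.I = -(y * -Complex.I) * x by ring,
    show -((x : ℂ) * y) * Complex.I = -(y * Complex.I) * x by ring]
  ring

/-! ### Gamma identities and the Meijer integrands -/

/-- Duplication at `s` and at `s + 1/4` leaves the pair `2s`, `2s + 1/2`, to which duplication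
applies once more. -/
theorem Gamma_mul_four (s : ℂ) :
    Complex.Gamma s * Complex.Gamma (s + 1 / 4) * Complex.Gamma (s + 1 / 2) *
        Complex.Gamma (s + 3 / 4) =
      (2 : ℂ) ^ (5 / 2 - 8 * s) * Real.pi * (Real.sqrt Real.pi : ℂ) * Complex.Gamma (4 * s) := by
  have h1 := Complex.Gamma_mul_Gamma_add_half s
  have h2 := Complex.Gamma_mul_Gamma_add_half (s + 1 / 4)
  have h3 := Complex.Gamma_mul_Gamma_add_half (2 * s)
  rw [show s + 1 / 4 + 1 / 2 = s + 3 / 4 by ring,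
    show 2 * (s + 1 / 4) = 2 * s + 1 / 2 by ring] at h2
  rw [show 2 * (2 * s) = 4 * s by ring] at h3
  have hπ : (Real.sqrt Real.pi : ℂ) * (Real.sqrt Real.pi : ℂ) = Real.pi := by
    rw [← Complex.ofReal_mul, Real.mul_self_sqrt Real.pi_pos.le]
  have e : (2 : ℂ) ^ (5 / 2 - 8 * s) =
      (2 : ℂ) ^ (1 - 2 * s) * (2 : ℂ) ^ (1 - (2 * s + 1 / 2)) * (2 : ℂ) ^ (1 - 4 * s) := by
    rw [← Complex.cpow_add _ _ two_ne_zero, ← Complex.cpow_add _ _ two_ne_zero]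
    congr 1; ring
  calc _ = (Complex.Gamma s * Complex.Gamma (s + 1 / 2)) *
        (Complex.Gamma (s + 1 / 4) * Complex.Gamma (s + 3 / 4)) := by ring
    _ = (Complex.Gamma (2 * s) * Complex.Gamma (2 * s + 1 / 2)) * (2 : ℂ) ^ (1 - 2 * s) *
        (2 : ℂ) ^ (1 - (2 * s + 1 / 2)) *
        ((Real.sqrt Real.pi : ℂ) * (Real.sqrt Real.pi : ℂ)) := by rw [h1, h2]; ring
    _ = _ := by rw [h3, hπ, e]; ring

/-- This is the reflection formula. It also covers the poles of `Γ(1/2 + ζ)`, where `Γ` takes the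
default value `0` and the cosine vanishes. -/
theorem inv_Gamma_half_add {ζ : ℂ} (hζ : ζ.re < 1 / 2) :
    (Complex.Gamma (1 / 2 + ζ))⁻¹ =
      Complex.Gamma (1 / 2 - ζ) * Complex.cos (Real.pi * ζ) / Real.pi := by
  have h := Complex.Gamma_mul_Gamma_one_sub (1 / 2 + ζ)
  have hs : Complex.sin (Real.pi * (1 / 2 + ζ)) = Complex.cos (Real.pi * ζ) := by
    rw [← Complex.sin_add_pi_div_two]; congr 1; ring
  have hne : Complex.Gamma (1 / 2 - ζ) ≠ 0 :=
    Complex.Gamma_ne_zero_of_re_pos (by simp at hζ ⊢; linarith)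
  rw [hs, show 1 - (1 / 2 + ζ) = 1 / 2 - ζ by ring] at h
  have h' := congrArg Inv.inv h
  rw [mul_inv, inv_div] at h'
  rw [mul_div_assoc, ← h', mul_comm (Complex.Gamma _)⁻¹, ← mul_assoc, mul_inv_cancel₀ hne, one_mul]

/-- Powers of `64 y² / a⁴` with the argument `-4 arg a`. -/
theorem exp_log_mul {a : ℂ} (ha : a ≠ 0) {y : ℝ} (hy : 0 < y) (ζ : ℂ) :
    Complex.exp (((Real.log (64 * y ^ 2) : ℂ) - 4 * Complex.log a) * ζ) =
      (2 : ℂ) ^ (6 * ζ) * (y : ℂ) ^ (2 * ζ) * a ^ (-(4 * ζ)) := by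
  have hy0 : (y : ℂ) ≠ 0 := by exact_mod_cast hy.ne'
  have h64 : Real.log (64 * y ^ 2) = 6 * Real.log 2 + 2 * Real.log y := by
    rw [show (64 : ℝ) = 2 ^ 6 by norm_num, Real.log_mul (by norm_num) (by positivity),
      Real.log_pow, Real.log_pow]
    norm_num
  rw [h64, Complex.cpow_def_of_ne_zero two_ne_zero, Complex.cpow_def_of_ne_zero hy0,
    Complex.cpow_def_of_ne_zero ha, ← Complex.exp_add, ← Complex.exp_add,
    ← Complex.ofReal_log hy.le,
    show Complex.log 2 = (Real.log 2 : ℂ) by rw [Complex.ofReal_log zero_le_two]; rfl]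
  congr 1
  push_cast
  ring

theorem meijerIntegrand_eq_cosKernel {υ a : ℂ} (ha : a ≠ 0) {y : ℝ} (hy : 0 < y) {ζ : ℂ}
    (hζ : ζ.re < 0) :
    meijerIntegrand ![(4 - 2 * υ) / 4, (3 - 2 * υ) / 4, (2 - 2 * υ) / 4, (1 - 2 * υ) / 4]
        ![] ![0] ![1 / 2] ((Real.log (64 * y ^ 2) : ℂ) - 4 * Complex.log a) ζ =
      Real.pi * (2 : ℂ) ^ (7 / 2 - 4 * υ) * a ^ (2 * υ) * cosKernel υ a y (-2 * ζ) := by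
  have h4 := Gamma_mul_four (υ / 2 + ζ)
  have hd := Complex.Gamma_mul_Gamma_add_half (-ζ)
  have hi := inv_Gamma_half_add (ζ := ζ) (by linarith)
  have hπ : (Real.sqrt Real.pi : ℂ) * (Real.sqrt Real.pi : ℂ) = Real.pi := by
    rw [← Complex.ofReal_mul, Real.mul_self_sqrt Real.pi_pos.le]
  have hπ0 : (Real.pi : ℂ) ≠ 0 := by exact_mod_cast Real.pi_ne_zero
  have e2 : (2 : ℂ) ^ (7 / 2 - 4 * υ) = (2 : ℂ) ^ (5 / 2 - 8 * (υ / 2 + ζ)) *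
      (2 : ℂ) ^ (1 - 2 * -ζ) * (2 : ℂ) ^ (6 * ζ) := by
    rw [← Complex.cpow_add _ _ two_ne_zero, ← Complex.cpow_add _ _ two_ne_zero]
    congr 1; ring
  have ea : a ^ (-(4 * ζ)) = a ^ (2 * υ) * a ^ (-(2 * (υ - -2 * ζ))) := by
    rw [← Complex.cpow_add _ _ ha]
    congr 1; ring
  have e0 : meijerIntegrand ![(4 - 2 * υ) / 4, (3 - 2 * υ) / 4, (2 - 2 * υ) / 4, (1 - 2 * υ) / 4]
        ![] ![0] ![1 / 2] ((Real.log (64 * y ^ 2) : ℂ) - 4 * Complex.log a) ζ =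
      Complex.Gamma (-ζ) * (Complex.Gamma (υ / 2 + ζ) * Complex.Gamma (υ / 2 + ζ + 1 / 4) *
        Complex.Gamma (υ / 2 + ζ + 1 / 2) * Complex.Gamma (υ / 2 + ζ + 3 / 4)) *
        (Complex.Gamma (1 / 2 + ζ))⁻¹ *
        Complex.exp (((Real.log (64 * y ^ 2) : ℂ) - 4 * Complex.log a) * ζ) := by
    simp only [meijerIntegrand, Fin.prod_univ_four, Fin.prod_univ_zero, Fin.prod_univ_one,
      Matrix.cons_val, mul_one, div_eq_mul_inv (_ * _) (Complex.Gamma _)]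
    congr 3
    · ring_nf
    · ring_nf
    · congr 1; ring
  rw [e0, h4, hi, exp_log_mul ha hy, cosKernel, e2, ea,
    show -(-2 * ζ) = 2 * ζ by ring, show Real.pi * (-2 * ζ) / 2 = -(Real.pi * ζ) by ring,
    Complex.cos_neg, show 4 * (υ / 2 + ζ) = 2 * (υ - -2 * ζ) by ring,
    show (-2 * ζ) = 2 * -ζ by ring]
  rw [show -ζ + 1 / 2 = 1 / 2 - ζ by ring] at hd
  calc _ = (Complex.Gamma (-ζ) * Complex.Gamma (1 / 2 - ζ)) * (Real.sqrt Real.pi : ℂ) *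
        (Real.pi / Real.pi) * ((2 : ℂ) ^ (5 / 2 - 8 * (υ / 2 + ζ)) * (2 : ℂ) ^ (6 * ζ) *
          (y : ℂ) ^ (2 * ζ) * a ^ (2 * υ) * a ^ (-(2 * (υ - 2 * -ζ))) *
          Complex.cos (Real.pi * ζ) * Complex.Gamma (2 * (υ - 2 * -ζ))) := by ring
    _ = Complex.Gamma (2 * -ζ) * (2 : ℂ) ^ (1 - 2 * -ζ) *
        ((Real.sqrt Real.pi : ℂ) * (Real.sqrt Real.pi : ℂ)) *
        ((2 : ℂ) ^ (5 / 2 - 8 * (υ / 2 + ζ)) * (2 : ℂ) ^ (6 * ζ) *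
          (y : ℂ) ^ (2 * ζ) * a ^ (2 * υ) * a ^ (-(2 * (υ - 2 * -ζ))) *
          Complex.cos (Real.pi * ζ) * Complex.Gamma (2 * (υ - 2 * -ζ))) := by
        rw [hd, div_self hπ0]; ring
    _ = _ := by rw [hπ]; ring

theorem exp_log_mul_eight {a : ℂ} {y : ℝ} (hy : 0 < y) (ζ : ℂ) :
    Complex.exp (((Real.log (4 ^ 8 * y ^ 4) : ℂ) - 8 * Complex.log a) * ζ) =
      (2 : ℂ) ^ (4 * ζ) *
        Complex.exp (((Real.log (64 * y ^ 2) : ℂ) - 4 * Complex.log a) * (2 * ζ)) := by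
  have h : Real.log (4 ^ 8 * y ^ 4) = 4 * Real.log 2 + 2 * Real.log (64 * y ^ 2) := by
    rw [show (4 : ℝ) ^ 8 * y ^ 4 = 2 ^ 4 * (64 * y ^ 2) ^ 2 by ring,
      Real.log_mul (by norm_num) (by positivity), Real.log_pow, Real.log_pow]
    norm_num
  rw [h, Complex.cpow_def_of_ne_zero two_ne_zero, ← Complex.exp_add,
    show Complex.log 2 = (Real.log 2 : ℂ) by rw [Complex.ofReal_log zero_le_two]; rfl]
  congr 1
  push_cast
  ring

/-- The eight upper factors pair at distance `1/2` into the four factors at `2ζ`, and so do both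
lower groups. The leftover powers of `2` depending on `ζ` are absorbed by `4⁸ y⁴ = 2⁴ (64 y²)²`. -/
theorem meijerIntegrand_eight_eq {υ a : ℂ} {y : ℝ} (hy : 0 < y) (ζ : ℂ) :
    meijerIntegrand ![(8 - 2 * υ) / 8, (7 - 2 * υ) / 8, (6 - 2 * υ) / 8, (5 - 2 * υ) / 8,
          (4 - 2 * υ) / 8, (3 - 2 * υ) / 8, (2 - 2 * υ) / 8, (1 - 2 * υ) / 8]
        ![] ![0, 1 / 2] ![1 / 4, 3 / 4]
        ((Real.log (4 ^ 8 * y ^ 4) : ℂ) - 8 * Complex.log a) ζ =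
      Real.pi ^ 2 * (2 : ℂ) ^ (3 - 2 * υ) *
      meijerIntegrand ![(4 - 2 * υ) / 4, (3 - 2 * υ) / 4, (2 - 2 * υ) / 4, (1 - 2 * υ) / 4]
        ![] ![0] ![1 / 2] ((Real.log (64 * y ^ 2) : ℂ) - 4 * Complex.log a) (2 * ζ) := by
  have hπ : (Real.sqrt Real.pi : ℂ) ^ 2 = Real.pi := by
    rw [← Complex.ofReal_pow, Real.sq_sqrt Real.pi_pos.le]
  have hπ0 : (Real.sqrt Real.pi : ℂ) ≠ 0 := by
    exact_mod_cast (Real.sqrt_pos.2 Real.pi_pos).ne'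
  set s : ℂ := υ / 4 + ζ with hs
  have hn := Complex.Gamma_mul_Gamma_add_half (-ζ)
  have hd := Complex.Gamma_mul_Gamma_add_half (1 / 4 + ζ)
  have h0 := Complex.Gamma_mul_Gamma_add_half s
  have h1 := Complex.Gamma_mul_Gamma_add_half (s + 1 / 8)
  have h2 := Complex.Gamma_mul_Gamma_add_half (s + 1 / 4)
  have h3 := Complex.Gamma_mul_Gamma_add_half (s + 3 / 8)
  have e2 : (2 : ℂ) ^ (3 - 2 * υ) * (2 : ℂ) ^ (1 - 2 * (1 / 4 + ζ)) = (2 : ℂ) ^ (1 - 2 * -ζ) *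
      ((2 : ℂ) ^ (1 - 2 * s) * (2 : ℂ) ^ (1 - 2 * (s + 1 / 8)) * (2 : ℂ) ^ (1 - 2 * (s + 1 / 4)) *
        (2 : ℂ) ^ (1 - 2 * (s + 3 / 8))) * (2 : ℂ) ^ (4 * ζ) := by
    simp only [← Complex.cpow_add _ _ (two_ne_zero (α := ℂ))]
    congr 1; rw [hs]; ring
  have hT : (2 : ℂ) ^ (1 - 2 * (1 / 4 + ζ)) ≠ 0 := by simp [Complex.cpow_eq_zero_iff]
  have eL : meijerIntegrand ![(8 - 2 * υ) / 8, (7 - 2 * υ) / 8, (6 - 2 * υ) / 8, (5 - 2 * υ) / 8,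
          (4 - 2 * υ) / 8, (3 - 2 * υ) / 8, (2 - 2 * υ) / 8, (1 - 2 * υ) / 8]
        ![] ![0, 1 / 2] ![1 / 4, 3 / 4]
        ((Real.log (4 ^ 8 * y ^ 4) : ℂ) - 8 * Complex.log a) ζ =
      (Complex.Gamma (-ζ) * Complex.Gamma (-ζ + 1 / 2)) *
        ((Complex.Gamma s * Complex.Gamma (s + 1 / 2)) *
          (Complex.Gamma (s + 1 / 8) * Complex.Gamma (s + 1 / 8 + 1 / 2)) *
          (Complex.Gamma (s + 1 / 4) * Complex.Gamma (s + 1 / 4 + 1 / 2)) *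
          (Complex.Gamma (s + 3 / 8) * Complex.Gamma (s + 3 / 8 + 1 / 2))) *
        (Complex.Gamma (1 / 4 + ζ) * Complex.Gamma (1 / 4 + ζ + 1 / 2))⁻¹ *
        Complex.exp (((Real.log (4 ^ 8 * y ^ 4) : ℂ) - 8 * Complex.log a) * ζ) := by
    simp only [meijerIntegrand, Fin.prod_univ_eight, Fin.prod_univ_zero, Fin.prod_univ_two,
      Matrix.cons_val, mul_one, div_eq_mul_inv (_ * _) (_ * _)]
    rw [show 0 - ζ = -ζ by ring, show 1 / 2 - ζ = -ζ + 1 / 2 by ring,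
      show 1 - 1 / 4 + ζ = 1 / 4 + ζ + 1 / 2 by ring, show 1 - 3 / 4 + ζ = 1 / 4 + ζ by ring,
      show 1 - (8 - 2 * υ) / 8 + ζ = s by rw [hs]; ring,
      show 1 - (7 - 2 * υ) / 8 + ζ = s + 1 / 8 by rw [hs]; ring,
      show 1 - (6 - 2 * υ) / 8 + ζ = s + 1 / 4 by rw [hs]; ring,
      show 1 - (5 - 2 * υ) / 8 + ζ = s + 3 / 8 by rw [hs]; ring,
      show 1 - (4 - 2 * υ) / 8 + ζ = s + 1 / 2 by rw [hs]; ring,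
      show 1 - (3 - 2 * υ) / 8 + ζ = s + 1 / 8 + 1 / 2 by rw [hs]; ring,
      show 1 - (2 - 2 * υ) / 8 + ζ = s + 1 / 4 + 1 / 2 by rw [hs]; ring,
      show 1 - (1 - 2 * υ) / 8 + ζ = s + 3 / 8 + 1 / 2 by rw [hs]; ring]
    ring
  have eR : meijerIntegrand ![(4 - 2 * υ) / 4, (3 - 2 * υ) / 4, (2 - 2 * υ) / 4, (1 - 2 * υ) / 4]
        ![] ![0] ![1 / 2] ((Real.log (64 * y ^ 2) : ℂ) - 4 * Complex.log a) (2 * ζ) =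
      Complex.Gamma (2 * -ζ) * (Complex.Gamma (2 * s) * Complex.Gamma (2 * (s + 1 / 8)) *
        Complex.Gamma (2 * (s + 1 / 4)) * Complex.Gamma (2 * (s + 3 / 8))) *
        (Complex.Gamma (2 * (1 / 4 + ζ)))⁻¹ *
        Complex.exp (((Real.log (64 * y ^ 2) : ℂ) - 4 * Complex.log a) * (2 * ζ)) := by
    simp only [meijerIntegrand, Fin.prod_univ_four, Fin.prod_univ_zero, Fin.prod_univ_one,
      Matrix.cons_val, mul_one, div_eq_mul_inv (_ * _) (Complex.Gamma _)]
    rw [show 0 - 2 * ζ = 2 * -ζ by ring, show 1 - 1 / 2 + 2 * ζ = 2 * (1 / 4 + ζ) by ring,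
      show 1 - (4 - 2 * υ) / 4 + 2 * ζ = 2 * s by rw [hs]; ring,
      show 1 - (3 - 2 * υ) / 4 + 2 * ζ = 2 * (s + 1 / 8) by rw [hs]; ring,
      show 1 - (2 - 2 * υ) / 4 + 2 * ζ = 2 * (s + 1 / 4) by rw [hs]; ring,
      show 1 - (1 - 2 * υ) / 4 + 2 * ζ = 2 * (s + 3 / 8) by rw [hs]; ring]
  have e2' := (eq_div_iff hT).2 e2
  rw [eL, eR, hn, hd, h0, h1, h2, h3, exp_log_mul_eight hy, e2', ← hπ]
  simp only [mul_inv, div_eq_mul_inv]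
  generalize Complex.Gamma (2 * (1 / 4 + ζ)) = G
  generalize (2 : ℂ) ^ (1 - 2 * (1 / 4 + ζ)) = T
  field_simp

/-! ### From integrands to values of the `G`-functions -/

/-- Multiplying by a power of the argument shifts all parameters of the Meijer integrand. -/
theorem meijerIntegrand_add_const {m n r s : ℕ} (a : Fin n → ℂ) (a' : Fin r → ℂ) (b : Fin m → ℂ)
    (b' : Fin s → ℂ) (w d ζ : ℂ) :
    meijerIntegrand (fun j => a j + d) (fun j => a' j + d) (fun j => b j + d) (fun j => b' j + d)
      w ζ = Complex.exp (w * d) * meijerIntegrand a a' b b' w (ζ - d) := by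
  have e1 : ∀ z : ℂ, z + d - ζ = z - (ζ - d) := fun z => by ring
  have e2 : ∀ z : ℂ, 1 - (z + d) + ζ = 1 - z + (ζ - d) := fun z => by ring
  simp only [meijerIntegrand, e1, e2]
  rw [show w * ζ = w * d + w * (ζ - d) by ring, Complex.exp_add]
  ring

/-- If the Meijer integrand is `C g(κ ζ + δ)` and the integral of `g` over vertical lines in the
strip `lo < Re < hi` is constant, then the Meijer function is given by this constant. -/
theorem meijerG_of_integrand_eq {m n r s : ℕ} {a : Fin n → ℂ} {a' : Fin r → ℂ} {b : Fin m → ℂ}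
    {b' : Fin s → ℂ} {w : ℂ} {g : ℂ → ℂ} {lo hi κ δ : ℝ} {C V : ℂ} (hlt : lo < hi) (hκ : κ ≠ 0)
    (hg : ∀ σ : ℝ, lo < σ → σ < hi → Integrable (fun t : ℝ => g (σ + t * Complex.I)) ∧
      ∫ t : ℝ, g (σ + t * Complex.I) = V)
    (hsep : ∀ γ : ℝ, IsSeparatingLine a b γ ↔ lo < κ * γ + δ ∧ κ * γ + δ < hi)
    (hint : ∀ ζ : ℂ, lo < κ * ζ.re + δ → κ * ζ.re + δ < hi →
      meijerIntegrand a a' b b' w ζ = C * g (κ * ζ + δ)) :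
    MeijerGConverges a a' b b' w ∧ meijerG a a' b b' w = C * V / (2 * Real.pi * |κ|) := by
  have hex : ∃ γ : ℝ, IsSeparatingLine a b γ := by
    refine ⟨((lo + hi) / 2 - δ) / κ, (hsep _).2 ?_⟩
    rw [mul_div_cancel₀ _ hκ]
    constructor <;> linarith
  have key : ∀ γ : ℝ, IsSeparatingLine a b γ →
      Integrable (fun t : ℝ => meijerIntegrand a a' b b' w ((γ : ℂ) + (t : ℂ) * Complex.I)) ∧
        meijerLineIntegral a a' b b' w γ = C * V / (2 * Real.pi * |κ|) := by
    intro γ hγ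
    obtain ⟨h1, h2⟩ := (hsep γ).1 hγ
    obtain ⟨hI, hV⟩ := hg _ h1 h2
    have e : ∀ t : ℝ, meijerIntegrand a a' b b' w ((γ : ℂ) + (t : ℂ) * Complex.I) =
        C * g (((κ * γ + δ : ℝ) : ℂ) + ((κ * t : ℝ) : ℂ) * Complex.I) := by
      intro t
      rw [hint _ (by simpa using h1) (by simpa using h2)]
      congr 2
      push_cast
      ring
    simp only [meijerLineIntegral, e]
    refine ⟨(hI.comp_mul_left' hκ).const_mul C, ?_⟩
    -- The rescaling `t ↦ κ t` contributes `1/|κ|`; the `i` of `dζ = i dt` cancels the one in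
    -- `1/(2πi)`.
    rw [integral_mul_const, integral_const_mul, Measure.integral_comp_mul_left
      (fun t : ℝ => g (((κ * γ + δ : ℝ) : ℂ) + (t : ℂ) * Complex.I)), hV, abs_inv,
      Complex.real_smul]
    have hI0 := Complex.I_ne_zero
    have hκ0 : ((|κ| : ℝ) : ℂ) ≠ 0 := by exact_mod_cast (abs_pos.2 hκ).ne'
    have hπ0 : (Real.pi : ℂ) ≠ 0 := by exact_mod_cast Real.pi_ne_zero
    push_cast
    field_simp
  have hG : meijerG a a' b b' w = C * V / (2 * Real.pi * |κ|) := by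
    rw [meijerG, dif_pos hex]
    exact (key _ hex.choose_spec).2
  exact ⟨⟨hex, fun γ hγ => ⟨(key γ hγ).1, (key γ hγ).2.trans hG.symm⟩⟩, hG⟩

/-- The real shift `d` treats four of the five forms at once: `s = -2(ζ - d)`, and the shift costs
the factor `z^d`. -/
theorem meijerG_four {υ a : ℂ} (hυ : 0 < υ.re) (ha : 0 < a.re) {y : ℝ} (hy : 0 < y) {J : ℂ}
    (hJ : J = ∫ x : ℝ in Ioi 0, (x : ℂ) ^ (υ - 1) * Complex.exp (-a * (Real.sqrt x : ℂ)) *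
      (Real.cos (x * y) : ℂ)) (d : ℝ) {α : Fin 4 → ℂ} {β β' : Fin 1 → ℂ}
    (hα : α = ![(4 - 2 * υ) / 4 + d, (3 - 2 * υ) / 4 + d, (2 - 2 * υ) / 4 + d,
      (1 - 2 * υ) / 4 + d]) (hβ : β = ![(d : ℂ)]) (hβ' : β' = ![1 / 2 + (d : ℂ)]) :
    MeijerGConverges α ![] β β' ((Real.log (64 * y ^ 2) : ℂ) - 4 * Complex.log a) ∧
    meijerG α ![] β β' ((Real.log (64 * y ^ 2) : ℂ) - 4 * Complex.log a) =
      (2 : ℂ) ^ (6 * (d : ℂ)) * (y : ℂ) ^ (2 * (d : ℂ)) * a ^ (-(4 * (d : ℂ))) *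
        (Real.pi * (2 : ℂ) ^ (7 / 2 - 4 * υ) * a ^ (2 * υ)) * J / 4 := by
  have ha0 : a ≠ 0 := fun h => by simp [h] at ha
  have hπ0 : (Real.pi : ℂ) ≠ 0 := by exact_mod_cast Real.pi_ne_zero
  have hsep : ∀ γ : ℝ, IsSeparatingLine α β γ ↔
      0 < (-2 : ℝ) * γ + 2 * d ∧ (-2 : ℝ) * γ + 2 * d < υ.re := by
    intro γ
    subst hα hβ
    have hre : ∀ c : ℝ, (((c : ℂ) - 2 * υ) / 4).re = (c - 2 * υ.re) / 4 := fun c => by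
      rw [show (4 : ℂ) = ((4 : ℝ) : ℂ) by norm_num, Complex.div_ofReal_re]
      simp
    have r4 := hre 4
    have r3 := hre 3
    have r2 := hre 2
    have r1 := hre 1
    push_cast at r4 r3 r2 r1
    constructor
    · rintro ⟨h1, h2⟩
      -- Only the extreme poles matter: `d` is the leftmost on the right, and `-υ/2 + d`, from the
      -- first upper parameter, has the largest real part on the left.
      have h1 := h1 0 0
      have h2 := h2 0 0
      simp [r4] at h1 h2
      constructor <;> linarith
    · rintro ⟨h1, h2⟩
      refine ⟨fun j l => ?_, fun j l => ?_⟩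
      · have := Nat.cast_nonneg (α := ℝ) l
        simp
        linarith
      · have := Nat.cast_nonneg (α := ℝ) l
        fin_cases j <;> simp [r1, r2, r3, r4] <;> linarith
  have h := meijerG_of_integrand_eq (a := α) (a' := ![]) (b := β) (b' := β')
    (w := (Real.log (64 * y ^ 2) : ℂ) - 4 * Complex.log a) (g := cosKernel υ a y) (lo := 0)
    (hi := υ.re) (κ := -2) (δ := 2 * d) (V := Real.pi * J)
    (C := (2 : ℂ) ^ (6 * (d : ℂ)) * (y : ℂ) ^ (2 * (d : ℂ)) * a ^ (-(4 * (d : ℂ))) *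
      (Real.pi * (2 : ℂ) ^ (7 / 2 - 4 * υ) * a ^ (2 * υ))) hυ (by norm_num)
    (fun σ h1 h2 => ⟨integrable_cosKernel_line ha hy h1 h2, by
      rw [hJ, integral_cos_eq_mellinBarnes ha hy h1 h2, ← mul_assoc,
        mul_one_div_cancel hπ0, one_mul]⟩) hsep ?_
  · refine ⟨h.1, h.2.trans ?_⟩
    rw [show |(-2 : ℝ)| = 2 by norm_num,
      div_eq_div_iff (by simp [hπ0]) (by norm_num)]
    push_cast
    ring
  · intro ζ h1 h2
    have e1 : α = fun j => (![(4 - 2 * υ) / 4, (3 - 2 * υ) / 4, (2 - 2 * υ) / 4,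
      (1 - 2 * υ) / 4] : Fin 4 → ℂ) j + d := by
      rw [hα]; ext j; fin_cases j <;> rfl
    have e2 : β = fun j => (![0] : Fin 1 → ℂ) j + d := by
      rw [hβ]; ext j; fin_cases j; simp
    have e3 : β' = fun j => (![1 / 2] : Fin 1 → ℂ) j + d := by
      rw [hβ']; ext j; fin_cases j; rfl
    have e4 : (![] : Fin 0 → ℂ) = fun j => (![] : Fin 0 → ℂ) j + d := Subsingleton.elim _ _
    have e := meijerIntegrand_add_const ![(4 - 2 * υ) / 4, (3 - 2 * υ) / 4, (2 - 2 * υ) / 4,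
      (1 - 2 * υ) / 4] ![] ![0] ![1 / 2] ((Real.log (64 * y ^ 2) : ℂ) - 4 * Complex.log a) d ζ
    rw [← e1, ← e2, ← e3, ← e4] at e
    rw [e, exp_log_mul ha0 hy,
      meijerIntegrand_eq_cosKernel ha0 hy (by simp; linarith)]
    rw [← mul_assoc]
    congr 2
    push_cast
    ring

theorem meijerG_eight {υ a : ℂ} (hυ : 0 < υ.re) (ha : 0 < a.re) {y : ℝ} (hy : 0 < y) {J : ℂ}
    (hJ : J = ∫ x : ℝ in Ioi 0, (x : ℂ) ^ (υ - 1) * Complex.exp (-a * (Real.sqrt x : ℂ)) *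
      (Real.cos (x * y) : ℂ)) {α : Fin 8 → ℂ}
    (hα : α = ![(8 - 2 * υ) / 8, (7 - 2 * υ) / 8, (6 - 2 * υ) / 8, (5 - 2 * υ) / 8,
          (4 - 2 * υ) / 8, (3 - 2 * υ) / 8, (2 - 2 * υ) / 8, (1 - 2 * υ) / 8]) :
    MeijerGConverges α ![] ![0, 1 / 2] ![1 / 4, 3 / 4]
      ((Real.log (4 ^ 8 * y ^ 4) : ℂ) - 8 * Complex.log a) ∧
    meijerG α ![] ![0, 1 / 2] ![1 / 4, 3 / 4]
        ((Real.log (4 ^ 8 * y ^ 4) : ℂ) - 8 * Complex.log a) =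
      Real.pi ^ 2 * (2 : ℂ) ^ (3 - 2 * υ) *
        (Real.pi * (2 : ℂ) ^ (7 / 2 - 4 * υ) * a ^ (2 * υ)) * J / 8 := by
  have ha0 : a ≠ 0 := fun h => by simp [h] at ha
  have hπ0 : (Real.pi : ℂ) ≠ 0 := by exact_mod_cast Real.pi_ne_zero
  subst hα
  have h := meijerG_of_integrand_eq (a := ![(8 - 2 * υ) / 8, (7 - 2 * υ) / 8, (6 - 2 * υ) / 8,
      (5 - 2 * υ) / 8, (4 - 2 * υ) / 8, (3 - 2 * υ) / 8, (2 - 2 * υ) / 8, (1 - 2 * υ) / 8])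
    (a' := ![]) (b := ![0, 1 / 2]) (b' := ![1 / 4, 3 / 4])
    (w := (Real.log (4 ^ 8 * y ^ 4) : ℂ) - 8 * Complex.log a) (g := cosKernel υ a y) (lo := 0)
    (hi := υ.re) (κ := -4) (δ := 0) (V := Real.pi * J)
    (C := Real.pi ^ 2 * (2 : ℂ) ^ (3 - 2 * υ) *
      (Real.pi * (2 : ℂ) ^ (7 / 2 - 4 * υ) * a ^ (2 * υ))) hυ (by norm_num)
    (fun σ h1 h2 => ⟨integrable_cosKernel_line ha hy h1 h2, by
      rw [hJ, integral_cos_eq_mellinBarnes ha hy h1 h2, ← mul_assoc,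
        mul_one_div_cancel hπ0, one_mul]⟩) ?_ ?_
  · refine ⟨h.1, h.2.trans ?_⟩
    rw [show |(-4 : ℝ)| = 4 by norm_num,
      div_eq_div_iff (by simp [hπ0]) (by norm_num)]
    push_cast
    ring
  · intro γ
    have hre : ∀ c : ℝ, (((c : ℂ) - 2 * υ) / 8).re = (c - 2 * υ.re) / 8 := fun c => by
      rw [show (8 : ℂ) = ((8 : ℝ) : ℂ) by norm_num, Complex.div_ofReal_re]
      simp
    have r8 := hre 8
    have r7 := hre 7
    have r6 := hre 6
    have r5 := hre 5
    have r4 := hre 4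
    have r3 := hre 3
    have r2 := hre 2
    have r1 := hre 1
    push_cast at r8 r7 r6 r5 r4 r3 r2 r1
    constructor
    · rintro ⟨h1, h2⟩
      have h1 := h1 0 0
      have h2 := h2 0 0
      simp [r8] at h1 h2
      constructor <;> linarith
    · rintro ⟨h1, h2⟩
      refine ⟨fun j l => ?_, fun j l => ?_⟩
      · have := Nat.cast_nonneg (α := ℝ) l
        fin_cases j <;> simp <;> linarith
      · have := Nat.cast_nonneg (α := ℝ) l
        fin_cases j <;> simp [r1, r2, r3, r4, r5, r6, r7, r8] <;> linarith
  · intro ζ h1 h2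
    rw [meijerIntegrand_eight_eq hy, meijerIntegrand_eq_cosKernel ha0 hy (by simp; linarith),
      ← mul_assoc]
    congr 2
    push_cast
    ring

/-! ### Summation over `k` -/

theorem summable_iStarTerm {Θ : ℕ → ℂ} (hΘ : Bornology.IsBounded (Set.range Θ))
    {υ b c lam : ℂ} {y : ℝ} (hυ : 0 < υ.re) (hc : 0 < c.re) (hconv : 0 < (lam * b).re) :
    Summable (iStarTerm Θ υ b c lam y) := by
  obtain ⟨B, hB⟩ := hΘ.exists_norm_le
  have hB0 : 0 ≤ B := (norm_nonneg _).trans (hB _ (mem_range_self 0))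
  have hI := (sqrt_laplace_integrableOn hυ hconv).norm
  set D : ℝ := ∫ x : ℝ in Ioi 0,
    ‖(x : ℂ) ^ (υ - 1) * Complex.exp (-(lam * b) * (Real.sqrt x : ℂ))‖
  have hs : Summable fun k : ℕ => B * D * ((1 : ℝ) ^ k / (k.factorial : ℝ)) :=
    (Real.summable_pow_div_factorial 1).mul_left _
  refine Summable.of_norm_bounded hs fun k => ?_
  have h1 : ‖∫ x in Ioi (0 : ℝ), cosIntegrand υ b c lam y k x‖ ≤ D := by
    -- The `k = 0` integrand without the cosine dominates every `k`, because `Re(c k) ≥ 0` and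
    -- `|cos| ≤ 1`.
    refine norm_integral_le_of_norm_le hI (Eventually.of_forall fun x => ?_)
    rw [cosIntegrand, norm_mul, norm_mul, norm_mul, Complex.norm_real]
    refine (mul_le_of_le_one_right (by positivity) (Real.abs_cos_le_one _)).trans ?_
    refine mul_le_mul_of_nonneg_left ?_ (norm_nonneg _)
    rw [Complex.norm_exp, Complex.norm_exp]
    apply Real.exp_le_exp.2
    rw [Complex.re_mul_ofReal, Complex.re_mul_ofReal]
    refine mul_le_mul_of_nonneg_right ?_ (Real.sqrt_nonneg x)
    have : (c * k).re = c.re * k := by simp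
    have : 0 ≤ c.re * k := by positivity
    simp only [Complex.neg_re, Complex.add_re]
    linarith
  rw [iStarTerm, norm_mul, norm_div, Complex.norm_natCast, one_pow]
  calc _ ≤ B / (k.factorial : ℝ) * D := by
        gcongr
        exact hB _ (mem_range_self k)
    _ = _ := by ring

theorem re_linear_pos {b c lam : ℂ} (hc : 0 < c.re) (hconv : 0 < (lam * b).re) (k : ℕ) :
    0 < (lam * b + c * k).re := by
  have : (c * k).re = c.re * k := by simp
  have : 0 ≤ c.re * k := by positivity
  rw [Complex.add_re]
  linarith

theorem meijerG_four_hasSum {Θ : ℕ → ℂ} (hΘ : Bornology.IsBounded (Set.range Θ))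
    {υ b c lam : ℂ} {y : ℝ} (hυ : 0 < υ.re) (hc : 0 < c.re) (hy : 0 < y)
    (hconv : 0 < (lam * b).re) (d : ℝ) {α : Fin 4 → ℂ} {β β' : Fin 1 → ℂ} {N e : ℂ}
    (hα : α = ![(4 - 2 * υ) / 4 + d, (3 - 2 * υ) / 4 + d, (2 - 2 * υ) / 4 + d,
      (1 - 2 * υ) / 4 + d]) (hβ : β = ![(d : ℂ)]) (hβ' : β' = ![1 / 2 + (d : ℂ)])
    (hN : N = (2 : ℂ) ^ (4 * υ - 3 / 2 - 6 * d) * (y : ℂ) ^ (-(2 * d : ℂ)) / Real.pi)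
    (he : e = 2 * υ - 4 * d) :
    (∀ k : ℕ, MeijerGConverges α ![] β β' (logArg₄ b c lam y k)) ∧
      HasSum (fun k : ℕ => N * (Θ k / ((k.factorial : ℂ) * (lam * b + c * k) ^ e) *
        meijerG α ![] β β' (logArg₄ b c lam y k))) (iStar Θ υ b c lam y) := by
  have key := fun k : ℕ => meijerG_four hυ (re_linear_pos hc hconv k) hy
    (J := ∫ x in Ioi (0 : ℝ), cosIntegrand υ b c lam y k x) rfl d hα hβ hβ'
  refine ⟨fun k => (key k).1, (summable_iStarTerm hΘ hυ hc hconv).hasSum.congr_fun ?_⟩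
  intro k
  have ha : lam * b + c * k ≠ 0 := fun h => by
    have := re_linear_pos hc hconv k
    simp [h] at this
  have hπ : (Real.pi : ℂ) ≠ 0 := by exact_mod_cast Real.pi_ne_zero
  have hy0 : (y : ℂ) ≠ 0 := by exact_mod_cast hy.ne'
  -- The powers of `2` from the prefactor, from `64^d` and from the integrand combine to `4`, which
  -- cancels the `1/4` in `meijerG_four`.
  have h2 : (2 : ℂ) ^ (4 * υ - 3 / 2 - 6 * (d : ℂ)) * (2 : ℂ) ^ (6 * (d : ℂ)) *
      (2 : ℂ) ^ (7 / 2 - 4 * υ) = 4 := by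
    rw [← Complex.cpow_add _ _ two_ne_zero, ← Complex.cpow_add _ _ two_ne_zero,
      show 4 * υ - 3 / 2 - 6 * (d : ℂ) + 6 * d + (7 / 2 - 4 * υ) = (2 : ℕ) by push_cast; ring,
      Complex.cpow_natCast]
    norm_num
  have h3 : (y : ℂ) ^ (-(2 * d : ℂ)) * (y : ℂ) ^ (2 * d : ℂ) = 1 := by
    rw [← Complex.cpow_add _ _ hy0, neg_add_cancel, Complex.cpow_zero]
  have h4 : (lam * b + c * k) ^ (-(4 * (d : ℂ))) * (lam * b + c * k) ^ (2 * υ) =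
      (lam * b + c * k) ^ e := by
    rw [← Complex.cpow_add _ _ ha, he]
    congr 1; ring
  have h5 : (lam * b + c * k) ^ e ≠ 0 := by simp [Complex.cpow_eq_zero_iff, ha]
  rw [iStarTerm, logArg₄, (key k).2, hN]
  set J := ∫ x in Ioi (0 : ℝ), cosIntegrand υ b c lam y k x
  calc _ = ((2 : ℂ) ^ (4 * υ - 3 / 2 - 6 * (d : ℂ)) * (2 : ℂ) ^ (6 * (d : ℂ)) *
        (2 : ℂ) ^ (7 / 2 - 4 * υ)) / 4 * ((y : ℂ) ^ (-(2 * d : ℂ)) * (y : ℂ) ^ (2 * d : ℂ)) *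
        (Real.pi / Real.pi) * (Θ k / (k.factorial : ℂ)) *
        (((lam * b + c * k) ^ (-(4 * (d : ℂ))) * (lam * b + c * k) ^ (2 * υ)) /
          (lam * b + c * k) ^ e) * J := by
        rw [div_mul_eq_div_div]; ring
    _ = _ := by
        rw [h2, h3, h4, div_self hπ, div_self h5]; ring

theorem meijerG_eight_hasSum {Θ : ℕ → ℂ} (hΘ : Bornology.IsBounded (Set.range Θ))
    {υ b c lam : ℂ} {y : ℝ} (hυ : 0 < υ.re) (hc : 0 < c.re) (hy : 0 < y)
    (hconv : 0 < (lam * b).re) {α : Fin 8 → ℂ}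
    (hα : α = ![(8 - 2 * υ) / 8, (7 - 2 * υ) / 8, (6 - 2 * υ) / 8, (5 - 2 * υ) / 8,
          (4 - 2 * υ) / 8, (3 - 2 * υ) / 8, (2 - 2 * υ) / 8, (1 - 2 * υ) / 8]) :
    (∀ k : ℕ, MeijerGConverges α ![] ![0, 1 / 2] ![1 / 4, 3 / 4] (logArg₈ b c lam y k)) ∧
      HasSum (fun k : ℕ => (2 : ℂ) ^ (6 * υ - 7 / 2) / (Real.pi : ℂ) ^ 3 *
        (Θ k / ((k.factorial : ℂ) * (lam * b + c * k) ^ (2 * υ)) *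
        meijerG α ![] ![0, 1 / 2] ![1 / 4, 3 / 4] (logArg₈ b c lam y k)))
        (iStar Θ υ b c lam y) := by
  have key := fun k : ℕ => meijerG_eight hυ (re_linear_pos hc hconv k) hy
    (J := ∫ x in Ioi (0 : ℝ), cosIntegrand υ b c lam y k x) rfl hα
  refine ⟨fun k => (key k).1, (summable_iStarTerm hΘ hυ hc hconv).hasSum.congr_fun ?_⟩
  intro k
  have ha : lam * b + c * k ≠ 0 := fun h => by
    have := re_linear_pos hc hconv k
    simp [h] at this
  have hπ : (Real.pi : ℂ) ^ 3 ≠ 0 := by exact_mod_cast pow_ne_zero 3 Real.pi_ne_zero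
  have h2 : (2 : ℂ) ^ (6 * υ - 7 / 2) * (2 : ℂ) ^ (3 - 2 * υ) *
      (2 : ℂ) ^ (7 / 2 - 4 * υ) = 8 := by
    rw [← Complex.cpow_add _ _ two_ne_zero, ← Complex.cpow_add _ _ two_ne_zero,
      show 6 * υ - 7 / 2 + (3 - 2 * υ) + (7 / 2 - 4 * υ) = (3 : ℕ) by push_cast; ring,
      Complex.cpow_natCast]
    norm_num
  have h5 : (lam * b + c * k) ^ (2 * υ) ≠ 0 := by simp [Complex.cpow_eq_zero_iff, ha]
  rw [iStarTerm, logArg₈, (key k).2]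
  set J := ∫ x in Ioi (0 : ℝ), cosIntegrand υ b c lam y k x
  calc _ = ((2 : ℂ) ^ (6 * υ - 7 / 2) * (2 : ℂ) ^ (3 - 2 * υ) *
        (2 : ℂ) ^ (7 / 2 - 4 * υ)) / 8 * ((Real.pi : ℂ) ^ 3 / (Real.pi : ℂ) ^ 3) *
        (Θ k / (k.factorial : ℂ)) *
        ((lam * b + c * k) ^ (2 * υ) / (lam * b + c * k) ^ (2 * υ)) * J := by
        rw [div_mul_eq_div_div]; ring
    _ = _ := by
        rw [h2, div_self hπ, div_self h5]; ring

theorem ofReal_sqrt_eq_cpow {y : ℝ} (hy : 0 ≤ y) : (Real.sqrt y : ℂ) = (y : ℂ) ^ (1 / 2 : ℂ) := by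
  rw [Real.sqrt_eq_rpow, Complex.ofReal_cpow hy]
  norm_num

end RamanujanCosine

open RamanujanCosine in
theorem theorem1 (Θ : ℕ → ℂ) (hΘ : Bornology.IsBounded (Set.range Θ))
    (υ b c lam : ℂ) (y : ℝ) (hυ : 0 < υ.re) (hc : 0 < c.re) (hy : 0 < y)
    (hlamb : (0 < lam.re ∧ 0 < b.re) ∨ (lam.re < 0 ∧ b.re < 0))
    -- the integral for `k = 0` converges
    (hconv : 0 < (lam * b).re) :
    -- the integrals and the series defining `I*_C` converge
    (∀ k : ℕ, MeasureTheory.IntegrableOn (cosIntegrand υ b c lam y k) (Set.Ioi (0 : ℝ))) ∧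
    Summable (iStarTerm Θ υ b c lam y) ∧
    ((∀ k : ℕ, MeijerGConverges
          ![(4 - 2 * υ) / 4, (3 - 2 * υ) / 4, (2 - 2 * υ) / 4, (1 - 2 * υ) / 4]
          ![] ![0] ![1 / 2] (logArg₄ b c lam y k)) ∧
      HasSum (fun k : ℕ => (2 : ℂ) ^ (4 * υ - 3 / 2) / (Real.pi : ℂ) *
        (Θ k / ((k.factorial : ℂ) * (lam * b + c * k) ^ (2 * υ)) * meijerG
          ![(4 - 2 * υ) / 4, (3 - 2 * υ) / 4, (2 - 2 * υ) / 4, (1 - 2 * υ) / 4]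
          ![] ![0] ![1 / 2] (logArg₄ b c lam y k)))
        (iStar Θ υ b c lam y)) ∧
    ((∀ k : ℕ, MeijerGConverges
          ![(3 - 2 * υ) / 4, (2 - 2 * υ) / 4, (1 - 2 * υ) / 4, (-2 * υ) / 4]
          ![] ![-1 / 4] ![1 / 4] (logArg₄ b c lam y k)) ∧
      HasSum (fun k : ℕ => (Real.sqrt y : ℂ) * (2 : ℂ) ^ (4 * υ) / (Real.pi : ℂ) *
        (Θ k / ((k.factorial : ℂ) * (lam * b + c * k) ^ (2 * υ + 1)) * meijerG
          ![(3 - 2 * υ) / 4, (2 - 2 * υ) / 4, (1 - 2 * υ) / 4, (-2 * υ) / 4]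
          ![] ![-1 / 4] ![1 / 4] (logArg₄ b c lam y k)))
        (iStar Θ υ b c lam y)) ∧
    ((∀ k : ℕ, MeijerGConverges
          ![(6 - 2 * υ) / 4, (5 - 2 * υ) / 4, (4 - 2 * υ) / 4, (3 - 2 * υ) / 4]
          ![] ![1 / 2] ![1] (logArg₄ b c lam y k)) ∧
      HasSum (fun k : ℕ => (2 : ℂ) ^ (4 * υ - 9 / 2) / ((Real.pi : ℂ) * (y : ℂ)) *
        (Θ k / ((k.factorial : ℂ) * (lam * b + c * k) ^ (2 * υ - 2)) * meijerG
          ![(6 - 2 * υ) / 4, (5 - 2 * υ) / 4, (4 - 2 * υ) / 4, (3 - 2 * υ) / 4]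
          ![] ![1 / 2] ![1] (logArg₄ b c lam y k)))
        (iStar Θ υ b c lam y)) ∧
    ((∀ k : ℕ, MeijerGConverges
          ![(2 - 2 * υ) / 4, (1 - 2 * υ) / 4, (-2 * υ) / 4, (-1 - 2 * υ) / 4]
          ![] ![-1 / 2] ![0] (logArg₄ b c lam y k)) ∧
      HasSum (fun k : ℕ => (y : ℂ) * (2 : ℂ) ^ (4 * υ + 3 / 2) / (Real.pi : ℂ) *
        (Θ k / ((k.factorial : ℂ) * (lam * b + c * k) ^ (2 * υ + 2)) * meijerG
          ![(2 - 2 * υ) / 4, (1 - 2 * υ) / 4, (-2 * υ) / 4, (-1 - 2 * υ) / 4]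
          ![] ![-1 / 2] ![0] (logArg₄ b c lam y k)))
        (iStar Θ υ b c lam y)) ∧
    ((∀ k : ℕ, MeijerGConverges
          ![(8 - 2 * υ) / 8, (7 - 2 * υ) / 8, (6 - 2 * υ) / 8, (5 - 2 * υ) / 8, (4 - 2 * υ) / 8, (3 - 2 * υ) / 8, (2 - 2 * υ) / 8, (1 - 2 * υ) / 8]
          ![] ![0, 1 / 2] ![1 / 4, 3 / 4] (logArg₈ b c lam y k)) ∧
      HasSum (fun k : ℕ => (2 : ℂ) ^ (6 * υ - 7 / 2) / (Real.pi : ℂ) ^ 3 *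
        (Θ k / ((k.factorial : ℂ) * (lam * b + c * k) ^ (2 * υ)) * meijerG
          ![(8 - 2 * υ) / 8, (7 - 2 * υ) / 8, (6 - 2 * υ) / 8, (5 - 2 * υ) / 8, (4 - 2 * υ) / 8, (3 - 2 * υ) / 8, (2 - 2 * υ) / 8, (1 - 2 * υ) / 8]
          ![] ![0, 1 / 2] ![1 / 4, 3 / 4] (logArg₈ b c lam y k)))
        (iStar Θ υ b c lam y)) := by

  -- The shifts `d = 0, -1/4, 1/2, -1/2` are read off from the first lower parameter of each form.
  refine ⟨fun k => integrableOn_cos_integrand hυ (re_linear_pos hc hconv k) y,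
    summable_iStarTerm hΘ hυ hc hconv,
    meijerG_four_hasSum hΘ hυ hc hy hconv 0 ?_ ?_ ?_ ?_ ?_,
    meijerG_four_hasSum hΘ hυ hc hy hconv (-1 / 4) ?_ ?_ ?_ ?_ ?_,
    meijerG_four_hasSum hΘ hυ hc hy hconv (1 / 2) ?_ ?_ ?_ ?_ ?_,
    meijerG_four_hasSum hΘ hυ hc hy hconv (-1 / 2) ?_ ?_ ?_ ?_ ?_,
    meijerG_eight_hasSum hΘ hυ hc hy hconv rfl⟩
  · simp
  · simp
  · simp
  · simp
  · simp
  · ext j; fin_cases j <;> simp <;> ring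
  · simp
  · ext j; fin_cases j; simp; norm_num
  · rw [ofReal_sqrt_eq_cpow hy.le, mul_comm ((y : ℂ) ^ (1 / 2 : ℂ))]
    congr 3 <;> push_cast <;> ring
  · push_cast; ring
  · ext j; fin_cases j <;> simp <;> ring
  · simp
  · ext j; fin_cases j; simp; norm_num
  · rw [show -(2 * ((1 / 2 : ℝ) : ℂ)) = -1 by push_cast; ring, Complex.cpow_neg_one,
      show 4 * υ - 3 / 2 - 6 * ((1 / 2 : ℝ) : ℂ) = 4 * υ - 9 / 2 by push_cast; ring]
    rw [div_mul_eq_div_div, div_right_comm, div_eq_mul_inv _ (y : ℂ)]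
  · push_cast; ring
  · ext j; fin_cases j <;> simp <;> ring
  · simp
  · ext j; fin_cases j; simp; norm_num
  · rw [show -(2 * ((-1 / 2 : ℝ) : ℂ)) = 1 by push_cast; ring, Complex.cpow_one,
      show 4 * υ - 3 / 2 - 6 * ((-1 / 2 : ℝ) : ℂ) = 4 * υ + 3 / 2 by push_cast; ring,
      mul_comm (y : ℂ)]
  · push_cast; ring
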